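/- Let $m\ge 1$ be an integer and let $p=(p_0,\dots,p_m)$ be a strictly positive probability vector. The random noble means substitution $\zeta_m$ on the alphabet $\mathcal A=\{a,b\}$ maps $b\mapsto a$ and, for $0\le i\le m$, maps $a\mapsto a^{i}ba^{m-i}$ with probability $p_i$; it acts on words by applying it independently to each letter. A finite word is legal if, for some $k\ge 1$, it is a (contiguous) subword of a realisation of $\zeta_m^k(b)$; let $\mathcal D_{m,\ell}$ be the set of legal words of length $\ell$. Let $S$ be the shift on $\mathcal A^{\mathbb Z}$, $(Sx)_i=x_{i+1}$, and let the hull $\mathbb X_m\subset\mathcal A^{\mathbb Z}$ be the smallest closed shift-invariant set that contains all $x\in\mathcal A^{\mathbb Z}$ which are accumulation points of (realisations of) the sequence $(\zeta_m^k(a|a))_{k\ge 0}$, where $|$ marks the boundary between the positions $-1$ and $0$. For $\ell\ge 1$ let $M_{m,\ell}$ be the matrix of the induced substitution on $\mathcal D_{m,\ell}$: for $u,w=w_0\cdots w_{\ell-1}\in\mathcal D_{m,\ell}$, the entry $(M_{m,\ell})_{u,w}$ is the expected number of positions $0\le i<|\zeta_m(w_0)|$ with $v_{[i,i+\ell-1]}=u$,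 where $v=\zeta_m(w)=\zeta_m(w_0)\cdots\zeta_m(w_{\ell-1})$ is the random image of $w$. Let $\boldsymbol R_{m,\ell}$ be its right Perron–Frobenius eigenvector, normalised so that its entries sum to $1$. There is exactly one Borel measure $\mu_m$ on $\mathbb X_m$ such that $$\mu_m\bigl(\{v\in\mathbb X_m : v_{[k,k+\ell-1]}=w\}\bigr)=\boldsymbol R_{m,\ell}(w)\qquad\text{for all } k\in\mathbb Z,\ \ell\ge 1,\ w\in\mathcal D_{m,\ell},$$ and $\mu_m$ is a shift-invariant probability measure. For every $f\in L^1(\mathbb X_m,\mu_m)$ and every fixed $s\in\mathbb Z$, $$\lim_{N\to\infty}\frac1N\sum_{i=s}^{N+s-1}f(S^ix)=\int_{\mathbb X_m}f\,\mathrm d\mu_m$$ for $\mu_m$-almost every $x\in\mathbb X_m$. In particular, $\mu_m$ is ergodic for $S$. -/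

import Mathlib

open MeasureTheory Filter Topology

noncomputable section

namespace RNMS

/-- The binary alphabet. -/
inductive Letter : Type where
  | a : Letter
  | b : Letter
  deriving DecidableEq

instance : Fintype Letter where
  elems := {Letter.a, Letter.b}
  complete x := by cases x <;> simp

/-- The alphabet carries the discrete topology. -/
instance : TopologicalSpace Letter := ⊥

instance : DiscreteTopology Letter := ⟨rfl⟩

/-- The alphabet carries the discrete σ-algebra. -/
instance : MeasurableSpace Letter := ⊤

instance : DiscreteMeasurableSpace Letter := ⟨fun _ => trivial⟩

/-! ### The random noble means substitution -/

/-- The noble means substitution `ζ_{m,i}`, `0 ≤ i ≤ m`:  `a ↦ aⁱ b aᵐ⁻ⁱ`, `b ↦ a`. -/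
def nms (m : ℕ) (i : Fin (m + 1)) : Letter → List Letter
  | Letter.a =>
      List.replicate (i : ℕ) Letter.a ++ Letter.b :: List.replicate (m - (i : ℕ)) Letter.a
  | Letter.b => [Letter.a]

/-- The list of the images of the letters of `w` when `ζ_{m, c j}` is applied to the `j`-th letter.
In the random substitution the choices `c j` are independent with law `p`, so that `c` has
probability `∏ j, p (c j)`. -/
def letterImages (m : ℕ) {ℓ : ℕ} (w : Fin ℓ → Letter) (c : Fin ℓ → Fin (m + 1)) :
    List (List Letter) :=
  List.ofFn fun j => nms m (c j) (w j)

/-- `v` is a realisation of `ζ_m(w)`. (For a strictly positive probability vector, every choice has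
positive probability.) -/
def IsImage (m : ℕ) (w v : List Letter) : Prop :=
  ∃ c : Fin w.length → Fin (m + 1), v = (letterImages m w.get c).flatten

/-- `v` is a realisation of `ζ_m^k(w)`. -/
def IsIterImage (m : ℕ) : ℕ → List Letter → List Letter → Prop
  | 0, w, v => v = w
  | k + 1, w, v => ∃ u, IsIterImage m k w u ∧ IsImage m u v

/-- `w` is `ζ_m`-legal: for some `k ≥ 1` it is a (contiguous) subword of a realisation of
`ζ_m^k(b)`. -/
def IsLegal (m : ℕ) (w : List Letter) : Prop :=
  ∃ k, 1 ≤ k ∧ ∃ v, IsIterImage m k [Letter.b] v ∧ w <:+: v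

/-- The set `D_{m,ℓ}` of legal words of length `ℓ`. -/
abbrev LegalWord (m ℓ : ℕ) : Type := {w : Fin ℓ → Letter // IsLegal m (List.ofFn w)}

instance (m ℓ : ℕ) : Fintype (LegalWord m ℓ) := Fintype.ofFinite _

/-! ### The hull -/

/-- The two-sided sequence `x` agrees on `[-n, n - 1]` with the marked finite word `u|v`, in which
`v` starts at position `0` and `u` ends at position `-1`; in particular `u` and `v` have length at
least `n`. -/
def AgreesOn (n : ℕ) (x : ℤ → Letter) (u v : List Letter) : Prop :=
  ∀ j : ℕ, j < n → v[j]? = some (x j) ∧ u.reverse[j]? = some (x (-(j + 1)))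

/-- The accumulation points, in the local topology, of (the realisations of)
`ζ_m^k(a|a)`, `k ≥ 0`. -/
def accPoints (m : ℕ) : Set (ℤ → Letter) :=
  {x | ∀ n K : ℕ, ∃ k, K ≤ k ∧ ∃ u v, IsIterImage m k [Letter.a] u ∧
    IsIterImage m k [Letter.a] v ∧ AgreesOn n x u v}

/-- The shift on the full two-sided shift space, `(S x)_i = x_{i+1}`. -/
def shift : Equiv.Perm (ℤ → Letter) where
  toFun x i := x (i + 1)
  invFun x i := x (i - 1)
  left_inv x := by funext i; simp
  right_inv x := by funext i; simp

/-- The hull `𝕏_m`: the smallest closed shift-invariant set containing `accPoints m`. -/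
def hull (m : ℕ) : Set (ℤ → Letter) :=
  ⋂₀ {Y | IsClosed Y ∧ shift ⁻¹' Y = Y ∧ accPoints m ⊆ Y}

theorem shift_mem_hull (m : ℕ) (x : ℤ → Letter) : shift x ∈ hull m ↔ x ∈ hull m := by
  simp only [hull, Set.mem_sInter]
  refine forall₂_congr fun Y hY => ?_
  rw [← Set.mem_preimage, hY.2.1]

/-- The shift on the hull. -/
def hullShift (m : ℕ) : Equiv.Perm (hull m) :=
  shift.subtypePerm (shift_mem_hull m)

/-- The cylinder set `Z_k(w) = {v ∈ 𝕏_m | v_{[k, k+ℓ-1]} = w}`. -/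
def cylinder (m : ℕ) {ℓ : ℕ} (k : ℤ) (w : Fin ℓ → Letter) : Set (hull m) :=
  {v | ∀ j : Fin ℓ, (v : ℤ → Letter) (k + (j : ℕ)) = w j}

/-! ### The induced substitution and the measure -/

/-- The image of the legal word `w = w_0 ⋯ w_{ℓ-1}` under the induced substitution for the choices
`c`: with `v = ζ(w_0) ⋯ ζ(w_{ℓ-1})` it is the word
`v_{[0,ℓ-1]} v_{[1,ℓ]} ⋯ v_{[r-1,r+ℓ-2]}`, where `r = |ζ(w_0)|`, over the words of length `ℓ`. -/
def inducedImage (m : ℕ) {ℓ : ℕ} (w : Fin ℓ → Letter) (c : Fin ℓ → Fin (m + 1)) :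
    List (List Letter) :=
  (List.range ((letterImages m w c).headD []).length).map fun i =>
    ((letterImages m w c).flatten.drop i).take ℓ

/-- The induced substitution matrix `M_{m,ℓ}`: the entry `(u, w)` is the expected number of
occurrences of the letter `u` in the image of the letter `w` under the induced substitution. -/
def inducedMatrix (m : ℕ) (p : Fin (m + 1) → ℝ) (ℓ : ℕ) :
    Matrix (LegalWord m ℓ) (LegalWord m ℓ) ℝ :=
  fun u w => ∑ c : Fin ℓ → Fin (m + 1),
    (∏ j, p (c j)) * ((inducedImage m w.1 c).count (List.ofFn u.1) : ℝ)

/-- `R` is the statistically normalised right Perron–Frobenius eigenvector of `M`: its entries are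
positive with sum `1`, and it is a right eigenvector of `M` for an eigenvalue `r` that bounds the
modulus of every complex eigenvalue of `M`. -/
def IsRightPF {ι : Type*} [Fintype ι] (M : Matrix ι ι ℝ) (R : ι → ℝ) : Prop :=
  (∀ i, 0 < R i) ∧ ∑ i, R i = 1 ∧
    ∃ r : ℝ, M.mulVec R = r • R ∧
      ∀ (z : ℂ) (x : ι → ℂ), x ≠ 0 → (M.map Complex.ofReal).mulVec x = z • x → ‖z‖ ≤ r

/-- `μ` takes on all cylinder sets the values `μ(Z_k(w)) = R_{m,ℓ}(w)`, where `ℓ ≥ 1`, `w` is a legal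
word of length `ℓ`, `k ∈ ℤ` and `R_{m,ℓ}` is the right Perron–Frobenius eigenvector of
`M_{m,ℓ}`. -/
def HasPFCylinders (m : ℕ) (p : Fin (m + 1) → ℝ) (μ : Measure (hull m)) : Prop :=
  ∀ ℓ : ℕ, 1 ≤ ℓ → ∃ R : LegalWord m ℓ → ℝ, IsRightPF (inducedMatrix m p ℓ) R ∧
    ∀ (k : ℤ) (w : LegalWord m ℓ), μ (cylinder m k w.1) = ENNReal.ofReal (R w)

end RNMS

end

/-!
The expected number of occurrences of a word `u` in `ζ_m^k(a)` satisfies the length recursion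
`α (k + 2) = m * α (k + 1) + α k` up to a bounded error: the `m + 1` letters of `ζ_m(a)` are
inflated independently, and only occurrences of `u` across their borders are missed. Hence `u` has a
frequency. The frequencies of the legal words of length `ℓ` form a positive eigenvector of the
induced substitution matrix, and by positivity the only one up to scaling.

A weak limit of the means along the words `ζ_m^k(a)` is a shift-invariant measure that gives
cylinder sets the frequencies of their words. For ergodicity, write a long window of a typical
sequence as a concatenation of level-`k` inflated letters. These are independent, so the variance of
the number of occurrences of `u` in the window grows linearly with the number of blocks, and the
proportion of occurrences of `u` in windows of length `N` tends in `L²` to the frequency of `u`.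
Therefore every invariant set is independent of every cylinder set, hence of itself.
-/

noncomputable section

namespace RNMS

section Realisations

variable {m : ℕ}

theorem isImage_nil {v : List Letter} : IsImage m [] v ↔ v = [] := by
  constructor
  · rintro ⟨c, rfl⟩
    simp [letterImages]
  · rintro rfl
    exact ⟨fun _ => 0, by simp [letterImages]⟩

theorem letterImages_cons (x : Letter) (w : List Letter)
    (c : Fin (w.length + 1) → Fin (m + 1)) :
    letterImages m (x :: w).get c = nms m (c 0) x :: letterImages m w.get (fun j => c j.succ) :=
  List.ofFn_succ

theorem isImage_cons {x : Letter} {w v : List Letter} :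
    IsImage m (x :: w) v ↔ ∃ i v', IsImage m w v' ∧ v = nms m i x ++ v' := by
  constructor
  · rintro ⟨c, rfl⟩
    refine ⟨c 0, _, ⟨fun j => c j.succ, rfl⟩, ?_⟩
    rw [letterImages_cons x w c]
    rfl
  · rintro ⟨i, v', ⟨c, rfl⟩, rfl⟩
    refine ⟨(Fin.cons i c : Fin (w.length + 1) → Fin (m + 1)), ?_⟩
    rw [letterImages_cons x w]
    simp

theorem isImage_append {w₁ w₂ v : List Letter} :
    IsImage m (w₁ ++ w₂) v ↔ ∃ v₁ v₂, IsImage m w₁ v₁ ∧ IsImage m w₂ v₂ ∧ v = v₁ ++ v₂ := by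
  induction w₁ generalizing v with
  | nil => simp [isImage_nil]
  | cons x w₁ ih =>
    simp only [List.cons_append, isImage_cons, ih]
    constructor
    · rintro ⟨i, _, ⟨v₁, v₂, h₁, h₂, rfl⟩, rfl⟩
      exact ⟨_, v₂, ⟨i, v₁, h₁, rfl⟩, h₂, by simp⟩
    · rintro ⟨_, v₂, ⟨i, v₁, h₁, rfl⟩, h₂, rfl⟩
      exact ⟨i, _, ⟨v₁, v₂, h₁, h₂, rfl⟩, by simp⟩

theorem isIterImage_one {w v : List Letter} : IsIterImage m 1 w v ↔ IsImage m w v := by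
  simp [IsIterImage]

theorem isIterImage_add {j k : ℕ} {w v : List Letter} :
    IsIterImage m (j + k) w v ↔ ∃ u, IsIterImage m j w u ∧ IsIterImage m k u v := by
  induction k generalizing v with
  | zero => simp [IsIterImage]
  | succ k ih =>
    rw [← Nat.add_assoc]
    simp only [IsIterImage, ih]
    constructor
    · rintro ⟨u, ⟨u', h₁, h₂⟩, h⟩
      exact ⟨u', h₁, u, h₂, h⟩
    · rintro ⟨u', h₁, u, h₂, h⟩
      exact ⟨u, ⟨u', h₁, h₂⟩, h⟩

theorem isIterImage_append {k : ℕ} {w₁ w₂ v : List Letter} :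
    IsIterImage m k (w₁ ++ w₂) v ↔
      ∃ v₁ v₂, IsIterImage m k w₁ v₁ ∧ IsIterImage m k w₂ v₂ ∧ v = v₁ ++ v₂ := by
  induction k generalizing v with
  | zero => simp [IsIterImage]
  | succ k ih =>
    simp only [IsIterImage, ih]
    constructor
    · rintro ⟨_, ⟨u₁, u₂, h₁, h₂, rfl⟩, h⟩
      obtain ⟨v₁, v₂, h₁', h₂', rfl⟩ := isImage_append.1 h
      exact ⟨v₁, v₂, ⟨u₁, h₁, h₁'⟩, ⟨u₂, h₂, h₂'⟩, rfl⟩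
    · rintro ⟨v₁, v₂, ⟨u₁, h₁, h₁'⟩, ⟨u₂, h₂, h₂'⟩, rfl⟩
      exact ⟨_, ⟨u₁, u₂, h₁, h₂, rfl⟩, isImage_append.2 ⟨v₁, v₂, h₁', h₂', rfl⟩⟩

theorem exists_isImage (w : List Letter) : ∃ v, IsImage m w v := ⟨_, fun _ => 0, rfl⟩

theorem exists_isIterImage (k : ℕ) (w : List Letter) : ∃ v, IsIterImage m k w v := by
  induction k with
  | zero => exact ⟨w, rfl⟩
  | succ k ih =>
    obtain ⟨u, hu⟩ := ih
    obtain ⟨v, hv⟩ := exists_isImage (m := m) u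
    exact ⟨v, u, hu, hv⟩

theorem isIterImage_nil {k : ℕ} {v : List Letter} : IsIterImage m k [] v ↔ v = [] := by
  induction k generalizing v with
  | zero => rfl
  | succ k ih => simp [IsIterImage, ih, isImage_nil]

theorem isImage_b {v : List Letter} : IsImage m [Letter.b] v ↔ v = [Letter.a] := by
  simp [isImage_cons, isImage_nil, nms]

theorem isIterImage_succ_b {k : ℕ} {v : List Letter} :
    IsIterImage m (k + 1) [Letter.b] v ↔ IsIterImage m k [Letter.a] v := by
  rw [Nat.add_comm, isIterImage_add]
  simp [isIterImage_one, isImage_b]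

/-- The length `|ζ_m^k(x)|`, which does not depend on the realisation. -/
def imageLen (m : ℕ) : ℕ → Letter → ℕ
  | 0, _ => 1
  | k + 1, Letter.a => m * imageLen m k Letter.a + imageLen m k Letter.b
  | k + 1, Letter.b => imageLen m k Letter.a

/-- The length `|ζ_m^k(w)|` for a word `w`. -/
def wordLen (m k : ℕ) (w : List Letter) : ℕ := (w.map (imageLen m k)).sum

@[simp] theorem wordLen_nil (k : ℕ) : wordLen m k [] = 0 := rfl

@[simp] theorem wordLen_cons (k : ℕ) (x : Letter) (w : List Letter) :
    wordLen m k (x :: w) = imageLen m k x + wordLen m k w := by simp [wordLen]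

theorem wordLen_singleton (k : ℕ) (x : Letter) : wordLen m k [x] = imageLen m k x := by
  rw [wordLen_cons, wordLen_nil, add_zero]

@[simp] theorem wordLen_append (k : ℕ) (v w : List Letter) :
    wordLen m k (v ++ w) = wordLen m k v + wordLen m k w := by simp [wordLen]

@[simp] theorem wordLen_zero (w : List Letter) : wordLen m 0 w = w.length := by
  induction w with
  | nil => rfl
  | cons x w ih => simp [ih, imageLen, Nat.add_comm]

theorem wordLen_nms (k : ℕ) (i : Fin (m + 1)) (x : Letter) :
    wordLen m k (nms m i x) = imageLen m (k + 1) x := by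
  cases x with
  | a =>
    have hi : (i : ℕ) + (m - i) = m := by omega
    simp only [nms, wordLen_append, wordLen_cons, imageLen]
    simp only [wordLen, List.map_replicate, List.sum_replicate, smul_eq_mul]
    calc (i : ℕ) * imageLen m k Letter.a +
          (imageLen m k Letter.b + (m - i : ℕ) * imageLen m k Letter.a)
        = ((i : ℕ) + (m - i)) * imageLen m k Letter.a + imageLen m k Letter.b := by ring
      _ = _ := by rw [hi]
  | b => simp [nms, imageLen]

theorem IsImage.wordLen_eq {k : ℕ} {w v : List Letter} (h : IsImage m w v) :
    wordLen m k v = wordLen m (k + 1) w := by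
  induction w generalizing v with
  | nil => simp [isImage_nil.1 h]
  | cons x w ih =>
    obtain ⟨i, v', h', rfl⟩ := isImage_cons.1 h
    simp [ih h', wordLen_nms]

theorem IsIterImage.wordLen_eq {j k : ℕ} {w v : List Letter} (h : IsIterImage m j w v) :
    wordLen m k v = wordLen m (j + k) w := by
  induction j generalizing v k with
  | zero => simp [show v = w from h]
  | succ j ih =>
    obtain ⟨u, hu, huv⟩ := h
    rw [huv.wordLen_eq, ih hu]
    congr 1
    omega

theorem IsIterImage.length_eq {k : ℕ} {w v : List Letter} (h : IsIterImage m k w v) :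
    v.length = wordLen m k w := by
  rw [← wordLen_zero (m := m), h.wordLen_eq]
  rfl

theorem imageLen_pos (k : ℕ) (x : Letter) : 0 < imageLen m k x := by
  induction k generalizing x with
  | zero => simp [imageLen]
  | succ k ih =>
    cases x with
    | a => exact Nat.add_pos_right _ (ih _)
    | b => exact ih _

theorem length_le_wordLen (k : ℕ) (w : List Letter) : w.length ≤ wordLen m k w := by
  induction w with
  | nil => simp
  | cons x w ih =>
    have := imageLen_pos (m := m) k x
    simp only [List.length_cons, wordLen_cons]
    omega

theorem IsIterImage.length_le {k : ℕ} {w v : List Letter} (h : IsIterImage m k w v) :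
    w.length ≤ v.length :=
  h.length_eq ▸ length_le_wordLen k w

theorem imageLen_le_a (hm : 1 ≤ m) (k : ℕ) (x : Letter) :
    imageLen m k x ≤ imageLen m k Letter.a := by
  cases x with
  | a => rfl
  | b =>
    cases k with
    | zero => simp [imageLen]
    | succ k =>
      simp only [imageLen]
      exact le_trans (Nat.le_mul_of_pos_left _ hm) (Nat.le_add_right _ _)

theorem lt_imageLen_a (hm : 1 ≤ m) (k : ℕ) : k < imageLen m k Letter.a := by
  induction k with
  | zero => simp [imageLen]
  | succ k ih =>
    simp only [imageLen]
    have h1 : imageLen m k Letter.a ≤ m * imageLen m k Letter.a := Nat.le_mul_of_pos_left _ hm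
    have := imageLen_pos (m := m) k Letter.b
    omega

theorem le_imageLen (hm : 1 ≤ m) (k : ℕ) (x : Letter) : k ≤ imageLen m k x := by
  cases x with
  | a => exact (lt_imageLen_a hm k).le
  | b =>
    cases k with
    | zero => simp
    | succ k => exact lt_imageLen_a hm k

end Realisations

/-! ### Legal words -/

section Legal

variable {m : ℕ}

theorem IsLegal.infix {v w : List Letter} (h : IsLegal m v) (hw : w <:+: v) : IsLegal m w := by
  obtain ⟨k, hk, u, hu, hv⟩ := h
  exact ⟨k, hk, u, hu, hw.trans hv⟩

theorem IsIterImage.isLegal {k : ℕ} {v : List Letter} (h : IsIterImage m k [Letter.a] v) :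
    IsLegal m v :=
  ⟨k + 1, by omega, v, isIterImage_succ_b.2 h, List.infix_rfl⟩

theorem IsLegal.isIterImage {k : ℕ} {v w : List Letter} (hw : IsLegal m w)
    (h : IsIterImage m k w v) : IsLegal m v := by
  obtain ⟨j, hj, _, hu, s, t, rfl⟩ := hw
  obtain ⟨s', hs⟩ := exists_isIterImage (m := m) k s
  obtain ⟨t', ht⟩ := exists_isIterImage (m := m) k t
  refine ⟨j + k, by omega, s' ++ v ++ t', isIterImage_add.2 ⟨_, hu, ?_⟩, s', t', rfl⟩
  exact isIterImage_append.2 ⟨_, _, isIterImage_append.2 ⟨_, _, hs, h, rfl⟩, ht, rfl⟩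

theorem isImage_a (i : Fin (m + 1)) : IsImage m [Letter.a] (nms m i Letter.a) :=
  isImage_cons.2 ⟨i, [], isImage_nil.2 rfl, by simp⟩

theorem nms_last_a : nms m (Fin.last m) Letter.a = List.replicate m Letter.a ++ [Letter.b] := by
  simp [nms]

theorem nms_zero_a : nms m 0 Letter.a = Letter.b :: List.replicate m Letter.a := by
  simp [nms]

theorem isLegal_aa (hm : 1 ≤ m) : IsLegal m [Letter.a, Letter.a] := by
  obtain ⟨n, rfl⟩ : ∃ n, m = n + 1 := ⟨m - 1, by omega⟩
  obtain ⟨r, hr⟩ := exists_isImage (m := n + 1) (List.replicate n Letter.a)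
  have h₁ : IsIterImage (n + 1) 1 [Letter.a] (Letter.b :: Letter.a :: List.replicate n Letter.a) :=
    isIterImage_one.2 (by simpa [nms_zero_a, List.replicate_succ] using isImage_a (m := n + 1) 0)
  have h₂ : IsIterImage (n + 1) 2 [Letter.a]
      (Letter.a :: (nms (n + 1) (Fin.last _) Letter.a ++ r)) :=
    ⟨_, h₁, isImage_cons.2 ⟨0, _, isImage_cons.2 ⟨Fin.last _, r, hr, rfl⟩, rfl⟩⟩
  refine h₂.isLegal.infix ⟨[], List.replicate n Letter.a ++ [Letter.b] ++ r, ?_⟩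
  simp [nms_last_a, List.replicate_succ]

theorem IsIterImage.exists_prefix (hm : 1 ≤ m) {k : ℕ} {v : List Letter}
    (h : IsIterImage m k [Letter.a] v) (n : ℕ) :
    ∃ u, IsIterImage m (n + k) [Letter.a] u ∧ v <+: u := by
  induction n with
  | zero => exact ⟨v, by simpa using h, List.prefix_rfl⟩
  | succ n ih =>
    obtain ⟨u, hu, huv⟩ := ih
    obtain ⟨r, rfl⟩ : ∃ r, m = r + 1 := ⟨m - 1, by omega⟩
    obtain ⟨t, ht⟩ := exists_isIterImage (m := r + 1) (n + k)
      (List.replicate r Letter.a ++ [Letter.b])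
    refine ⟨u ++ t, ?_, huv.trans (List.prefix_append _ _)⟩
    rw [show n + 1 + k = 1 + (n + k) by omega, isIterImage_add]
    refine ⟨_, isIterImage_one.2 (isImage_a (Fin.last _)), ?_⟩
    rw [nms_last_a, List.replicate_succ, List.cons_append]
    exact isIterImage_append (w₁ := [Letter.a]).2 ⟨u, t, hu, ht, rfl⟩

end Legal

section Expect

variable {m : ℕ}

/-- `p` is a strictly positive probability vector. -/
structure IsPosProb (p : Fin (m + 1) → ℝ) : Prop where
  pos : ∀ i, 0 < p i
  sum_eq_one : ∑ i, p i = 1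

/-- The expectation of `g` over the realisations of `ζ_m(w)`. As an operator on functions of `w` its
`k`-th iterate is the expectation over the realisations of `ζ_m^k(w)`. -/
def expect (p : Fin (m + 1) → ℝ) : (List Letter → ℝ) → List Letter → ℝ
  | g, [] => g []
  | g, x :: w => ∑ i, p i * expect p (fun v => g (nms m i x ++ v)) w

variable {p : Fin (m + 1) → ℝ}

theorem expect_add (g g' : List Letter → ℝ) :
    expect p (fun v => g v + g' v) = fun w => expect p g w + expect p g' w := by
  funext w
  induction w generalizing g g' with
  | nil => rfl
  | cons x w ih => simp only [expect, ih, mul_add, Finset.sum_add_distrib]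

theorem expect_const_mul (c : ℝ) (g : List Letter → ℝ) :
    expect p (fun v => c * g v) = fun w => c * expect p g w := by
  funext w
  induction w generalizing g with
  | nil => rfl
  | cons x w ih => simp only [expect, ih, mul_left_comm, Finset.mul_sum]

theorem iterate_expect_add (k : ℕ) (g g' : List Letter → ℝ) (w : List Letter) :
    (expect p)^[k] (fun v => g v + g' v) w = (expect p)^[k] g w + (expect p)^[k] g' w := by
  induction k generalizing g g' with
  | zero => rfl
  | succ k ih => simp only [Function.iterate_succ_apply, expect_add, ih]

theorem iterate_expect_const_mul (k : ℕ) (c : ℝ) (g : List Letter → ℝ) (w : List Letter) :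
    (expect p)^[k] (fun v => c * g v) w = c * (expect p)^[k] g w := by
  induction k generalizing g with
  | zero => rfl
  | succ k ih => simp only [Function.iterate_succ_apply, expect_const_mul, ih]

theorem iterate_expect_sub (k : ℕ) (g g' : List Letter → ℝ) (w : List Letter) :
    (expect p)^[k] (fun v => g v - g' v) w = (expect p)^[k] g w - (expect p)^[k] g' w := by
  have h := iterate_expect_add (p := p) k g (fun v => -1 * g' v) w
  rw [iterate_expect_const_mul] at h
  simpa only [neg_one_mul, ← sub_eq_add_neg] using h

theorem iterate_expect_sum {ι : Type*} (s : Finset ι) (k : ℕ) (g : ι → List Letter → ℝ)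
    (w : List Letter) :
    (expect p)^[k] (fun v => ∑ i ∈ s, g i v) w = ∑ i ∈ s, (expect p)^[k] (g i) w := by
  classical
  induction s using Finset.induction_on with
  | empty => simpa using iterate_expect_const_mul (p := p) k 0 (fun _ => 0) w
  | insert i s hi ih => simp only [Finset.sum_insert hi, iterate_expect_add, ih]

theorem expect_sum {ι : Type*} (s : Finset ι) (g : ι → List Letter → ℝ) :
    expect p (fun v => ∑ i ∈ s, g i v) = fun w => ∑ i ∈ s, expect p (g i) w :=
  funext (iterate_expect_sum s 1 g)

theorem expect_iterate_expect_comm (k : ℕ) (u w : List Letter)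
    (F : List Letter → List Letter → ℝ) :
    expect p (fun x => (expect p)^[k] (F x) w) u =
      (expect p)^[k] (fun y => expect p (fun x => F x y) u) w := by
  induction u generalizing F with
  | nil => rfl
  | cons x u ih => simp only [expect, ih, iterate_expect_sum, iterate_expect_const_mul]

theorem expect_append (w₁ w₂ : List Letter) (g : List Letter → ℝ) :
    expect p g (w₁ ++ w₂) = expect p (fun v₁ => expect p (fun v₂ => g (v₁ ++ v₂)) w₂) w₁ := by
  induction w₁ generalizing g with
  | nil => rfl
  | cons x w₁ ih => simp only [List.cons_append, expect, ih, List.append_assoc]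

/-- Fubini: the images of `w₁` and of `w₂` are independent. -/
theorem iterate_expect_append (k : ℕ) (w₁ w₂ : List Letter) (g : List Letter → ℝ) :
    (expect p)^[k] g (w₁ ++ w₂) =
      (expect p)^[k] (fun v₁ => (expect p)^[k] (fun v₂ => g (v₁ ++ v₂)) w₂) w₁ := by
  induction k generalizing w₁ w₂ g with
  | zero => rfl
  | succ k ih =>
    simp only [Function.iterate_succ_apply', expect_append, ih, expect_iterate_expect_comm]

theorem iterate_expect_nil (k : ℕ) (g : List Letter → ℝ) : (expect p)^[k] g [] = g [] := by
  induction k generalizing g with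
  | zero => rfl
  | succ k ih => rw [Function.iterate_succ_apply, ih, expect]

theorem expect_mono (P : IsPosProb p) {w : List Letter} {g g' : List Letter → ℝ}
    (h : ∀ v, IsImage m w v → g v ≤ g' v) : expect p g w ≤ expect p g' w := by
  induction w generalizing g g' with
  | nil => exact h [] (isImage_nil.2 rfl)
  | cons x w ih =>
    exact Finset.sum_le_sum fun i _ => mul_le_mul_of_nonneg_left
      (ih fun v hv => h _ (isImage_cons.2 ⟨i, v, hv, rfl⟩)) (P.pos i).le

theorem expect_const (P : IsPosProb p) (c : ℝ) : expect p (fun _ => c) = fun _ => c := by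
  funext w
  induction w with
  | nil => rfl
  | cons x w ih => rw [expect, ih, ← Finset.sum_mul, P.sum_eq_one, one_mul]

theorem expect_pos (P : IsPosProb p) {w v : List Letter} {g : List Letter → ℝ}
    (h : ∀ v, 0 ≤ g v) (hv : IsImage m w v) (hgv : 0 < g v) : 0 < expect p g w := by
  induction w generalizing v g with
  | nil => rwa [expect, ← isImage_nil.1 hv]
  | cons x w ih =>
    obtain ⟨i, v', hv', rfl⟩ := isImage_cons.1 hv
    refine Finset.sum_pos' (fun j _ => mul_nonneg (P.pos j).le ?_)
      ⟨i, Finset.mem_univ i, mul_pos (P.pos i) (ih (fun _ => h _) hv' hgv)⟩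
    exact (congrFun (expect_const P 0) w).ge.trans (expect_mono P fun _ _ => h _)

theorem iterate_expect_mono (P : IsPosProb p) {k : ℕ} {w : List Letter} {g g' : List Letter → ℝ}
    (h : ∀ v, IsIterImage m k w v → g v ≤ g' v) :
    (expect p)^[k] g w ≤ (expect p)^[k] g' w := by
  induction k generalizing g g' with
  | zero => exact h w rfl
  | succ k ih => exact ih fun v hv => expect_mono P fun v' hv' => h v' ⟨v, hv, hv'⟩

theorem iterate_expect_const (P : IsPosProb p) (k : ℕ) (w : List Letter) (c : ℝ) :
    (expect p)^[k] (fun _ => c) w = c := by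
  rw [Function.iterate_fixed (expect_const P c)]

theorem iterate_expect_congr (P : IsPosProb p) {k : ℕ} {w : List Letter} {g g' : List Letter → ℝ}
    (h : ∀ v, IsIterImage m k w v → g v = g' v) :
    (expect p)^[k] g w = (expect p)^[k] g' w :=
  le_antisymm (iterate_expect_mono P fun v hv => (h v hv).le)
    (iterate_expect_mono P fun v hv => (h v hv).ge)

theorem iterate_expect_eq_const (P : IsPosProb p) {k : ℕ} {w : List Letter} {g : List Letter → ℝ}
    {c : ℝ} (h : ∀ v, IsIterImage m k w v → g v = c) : (expect p)^[k] g w = c :=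
  (iterate_expect_congr P h).trans (iterate_expect_const P k w c)

theorem iterate_expect_le_const (P : IsPosProb p) {k : ℕ} {w : List Letter} {g : List Letter → ℝ}
    {c : ℝ} (h : ∀ v, IsIterImage m k w v → g v ≤ c) : (expect p)^[k] g w ≤ c :=
  (iterate_expect_mono P h).trans_eq (iterate_expect_const P k w c)

theorem iterate_expect_nonneg (P : IsPosProb p) {k : ℕ} {w : List Letter} {g : List Letter → ℝ}
    (h : ∀ v, 0 ≤ g v) : 0 ≤ (expect p)^[k] g w :=
  (iterate_expect_const P k w 0).ge.trans (iterate_expect_mono P fun v _ => h v)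

theorem abs_iterate_expect_sub_le (P : IsPosProb p) {k : ℕ} {w : List Letter}
    {g g' : List Letter → ℝ} {C : ℝ} (h : ∀ v, IsIterImage m k w v → |g v - g' v| ≤ C) :
    |(expect p)^[k] g w - (expect p)^[k] g' w| ≤ C := by
  rw [abs_le', neg_sub, ← iterate_expect_sub, ← iterate_expect_sub]
  exact ⟨iterate_expect_le_const P fun v hv => (le_abs_self _).trans (h v hv),
    iterate_expect_le_const P fun v hv => (le_abs_self _).trans (abs_sub_comm (g v) _ ▸ h v hv)⟩

theorem iterate_expect_pos (P : IsPosProb p) {k : ℕ} {w v : List Letter} {g : List Letter → ℝ}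
    (h : ∀ v, 0 ≤ g v) (hv : IsIterImage m k w v) (hgv : 0 < g v) :
    0 < (expect p)^[k] g w := by
  induction k generalizing g v with
  | zero => exact (show v = w from hv) ▸ hgv
  | succ k ih =>
    obtain ⟨u, hu, huv⟩ := hv
    exact ih (fun _ => iterate_expect_nonneg (k := 1) P h) hu (expect_pos P h huv hgv)

theorem sum_choices (n : ℕ) (w : Fin n → Letter) (g : List Letter → ℝ) :
    ∑ c : Fin n → Fin (m + 1), (∏ j, p (c j)) * g (letterImages m w c).flatten =
      expect p g (List.ofFn w) := by
  induction n generalizing g with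
  | zero => simp [expect, letterImages]
  | succ n ih =>
    rw [List.ofFn_succ, expect, ← (Fin.consEquiv fun _ => Fin (m + 1)).sum_comp,
      Fintype.sum_prod_type]
    refine Finset.sum_congr rfl fun i _ => ?_
    rw [← ih, Finset.mul_sum]
    refine Finset.sum_congr rfl fun c _ => ?_
    simp [Fin.prod_univ_succ, letterImages, List.ofFn_succ, mul_assoc]

end Expect

section TailSum

variable {α : Type*}

/-- The sum of `F` over the nonempty suffixes of a word. -/
def tailSum (F : List α → ℝ) : List α → ℝ
  | [] => 0
  | x :: v => F (x :: v) + tailSum F v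

theorem tailSum_append (F : List α → ℝ) (v₁ v₂ : List α) :
    tailSum F (v₁ ++ v₂) = tailSum (fun t => F (t ++ v₂)) v₁ + tailSum F v₂ := by
  induction v₁ with
  | nil => simp [tailSum]
  | cons x v₁ ih => simp [tailSum, ih, add_assoc]

theorem tailSum_mono {F F' : List α → ℝ} {v : List α}
    (h : ∀ t, t ≠ [] → t <:+ v → F t ≤ F' t) : tailSum F v ≤ tailSum F' v := by
  induction v with
  | nil => exact le_rfl
  | cons x v ih =>
    exact add_le_add (h _ (by simp) List.suffix_rfl)
      (ih fun t ht hv => h t ht (hv.trans (List.suffix_cons x v)))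

theorem tailSum_congr {F F' : List α → ℝ} {v : List α}
    (h : ∀ t, t ≠ [] → t <:+ v → F t = F' t) : tailSum F v = tailSum F' v :=
  le_antisymm (tailSum_mono fun t ht hv => (h t ht hv).le)
    (tailSum_mono fun t ht hv => (h t ht hv).ge)

theorem tailSum_sum {ι : Type*} (s : Finset ι) (F : ι → List α → ℝ) (v : List α) :
    tailSum (fun t => ∑ i ∈ s, F i t) v = ∑ i ∈ s, tailSum (F i) v := by
  induction v with
  | nil => simp [tailSum]
  | cons x v ih => simp [tailSum, ih, Finset.sum_add_distrib]

theorem tailSum_const_mul (c : ℝ) (F : List α → ℝ) (v : List α) :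
    tailSum (fun t => c * F t) v = c * tailSum F v := by
  induction v with
  | nil => simp [tailSum]
  | cons x v ih => simp [tailSum, ih, mul_add]

theorem tailSum_const (c : ℝ) (v : List α) :
    tailSum (fun _ => c) v = v.length * c := by
  induction v with
  | nil => simp [tailSum]
  | cons x v ih =>
    rw [tailSum, ih, List.length_cons]
    push_cast
    ring

theorem tailSum_sub (F F' : List α → ℝ) (v : List α) :
    tailSum (fun t => F t - F' t) v = tailSum F v - tailSum F' v := by
  induction v with
  | nil => simp [tailSum]
  | cons x v ih => simp only [tailSum, ih]; ring

theorem tailSum_eq_sum_range (F : List α → ℝ) (v : List α) :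
    tailSum F v = ∑ i ∈ Finset.range v.length, F (v.drop i) := by
  induction v with
  | nil => simp [tailSum]
  | cons x v ih => simp [tailSum, ih, Finset.sum_range_succ', add_comm]

theorem tailSum_nonneg {F : List α → ℝ} (h : ∀ t, 0 ≤ F t) (v : List α) :
    0 ≤ tailSum F v := by
  rw [tailSum_eq_sum_range]
  exact Finset.sum_nonneg fun _ _ => h _

theorem abs_tailSum_le {F : List α → ℝ} {n : ℕ} {C : ℝ} {v : List α}
    (h₀ : ∀ t, t <:+ v → n ≤ t.length → F t = 0) (h₁ : ∀ t, t.length < n → |F t| ≤ C) :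
    |tailSum F v| ≤ (min v.length n : ℕ) * C := by
  induction v with
  | nil => simp [tailSum]
  | cons x v ih =>
    have ih' := ih fun t ht => h₀ t (ht.trans (List.suffix_cons x v))
    simp only [tailSum]
    by_cases hn : n ≤ (x :: v).length
    · rw [h₀ _ List.suffix_rfl hn, zero_add]
      refine ih'.trans ?_
      rcases n.eq_zero_or_pos with rfl | hn0
      · simp
      have hC : 0 ≤ C := (abs_nonneg _).trans (h₁ [] (by simpa using hn0))
      gcongr
      exact Nat.le_succ _
    · have h₂ := h₁ (x :: v) (by omega)
      simp only [List.length_cons] at hn ⊢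
      rw [min_eq_left (by omega)] at ih' ⊢
      push_cast
      linarith [abs_add_le (F (x :: v)) (tailSum F v)]

/-- `F` depends only on the first `n` letters. -/
def IsLocal (n : ℕ) (F : List α → ℝ) : Prop :=
  ∀ s t, n ≤ s.length → F (s ++ t) = F s

theorem IsLocal.take {n : ℕ} {F : List α → ℝ} (hF : IsLocal n F) {t : List α}
    (ht : n ≤ t.length) : F (t.take n) = F t := by
  conv_rhs => rw [← List.take_append_drop n t]
  exact (hF _ _ (by simp [ht])).symm

variable [DecidableEq α]

/-- The indicator function of the words with prefix `u`. -/
def prefixInd (u t : List α) : ℝ := if u <+: t then 1 else 0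

/-- The number of occurrences of the nonempty word `u` in a word. -/
def occ (u : List α) : List α → ℝ := tailSum (prefixInd u)

theorem prefixInd_nonneg (u t : List α) : 0 ≤ prefixInd u t := by
  rw [prefixInd]
  split_ifs <;> norm_num

theorem prefixInd_le_one (u t : List α) : prefixInd u t ≤ 1 := by
  rw [prefixInd]
  split_ifs <;> norm_num

theorem isLocal_prefixInd (u : List α) : IsLocal u.length (prefixInd u) := by
  intro s t h
  refine if_congr ⟨fun hu => ?_, fun hu => hu.trans (List.prefix_append s t)⟩ rfl rfl
  exact List.prefix_of_prefix_length_le hu (List.prefix_append s t) h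

theorem prefixInd_le_append (u s t : List α) : prefixInd u s ≤ prefixInd u (s ++ t) := by
  by_cases h : u <+: s
  · simp [prefixInd, h, h.trans (List.prefix_append s t)]
  · simpa [prefixInd, h] using prefixInd_nonneg u (s ++ t)

theorem occ_nonneg (u v : List α) : 0 ≤ occ u v := tailSum_nonneg (prefixInd_nonneg u) v

theorem occ_le_length (u v : List α) : occ u v ≤ v.length :=
  (tailSum_mono fun t _ _ => prefixInd_le_one u t).trans (by simp [tailSum_const])

theorem occ_add_le (u v w : List α) : occ u v + occ u w ≤ occ u (v ++ w) := by
  rw [occ, tailSum_append]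
  exact add_le_add_left (tailSum_mono fun t _ _ => prefixInd_le_append u t w) _

theorem tailSum_prefixInd_append_le (u v w : List α) :
    tailSum (fun t => prefixInd u (t ++ w)) v ≤ occ u v + (min v.length u.length : ℕ) := by
  induction v with
  | nil => simp [tailSum, occ]
  | cons x v ih =>
    simp only [occ, tailSum] at ih ⊢
    by_cases h : u.length ≤ (x :: v).length
    · rw [isLocal_prefixInd u (x :: v) w h]
      have : ((min v.length u.length : ℕ) : ℝ) ≤ (min (x :: v).length u.length : ℕ) := by
        exact_mod_cast min_le_min_right _ (by simp)
      linarith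
    · have h' : v.length + 1 ≤ u.length := by simp at h; omega
      rw [min_eq_left (by omega)] at ih
      rw [List.length_cons, min_eq_left h']
      have h₁ := prefixInd_le_one u (x :: v ++ w)
      have h₂ := prefixInd_nonneg u (x :: v)
      push_cast
      linarith

theorem occ_append_le (u v w : List α) :
    occ u (v ++ w) ≤ occ u v + occ u w + u.length := by
  rw [occ, tailSum_append]
  have h₁ := tailSum_prefixInd_append_le u v w
  have h₂ : ((min v.length u.length : ℕ) : ℝ) ≤ u.length := by
    exact_mod_cast min_le_right v.length u.length
  simp only [occ] at *
  linarith

theorem occ_pos {u v : List α} (hu : u ≠ []) (h : u <:+: v) : 0 < occ u v := by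
  obtain ⟨s, t, rfl⟩ := h
  rw [List.append_assoc]
  have h₁ := occ_add_le u s (u ++ t)
  have h₂ := occ_nonneg u s
  obtain ⟨x, u', rfl⟩ := List.exists_cons_of_ne_nil hu
  have h₃ : occ (x :: u') (x :: u' ++ t) =
    prefixInd (x :: u') (x :: u' ++ t) + occ (x :: u') (u' ++ t) := rfl
  have h₄ : prefixInd (x :: u') (x :: u' ++ t) = 1 := if_pos (List.prefix_append _ _)
  have h₅ := occ_nonneg (x :: u') (u' ++ t)
  linarith

theorem count_take_drop (u B r : List α) :
    ((((List.range B.length).map fun i => ((B ++ r).drop i).take u.length).count u : ℕ) : ℝ) =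
      tailSum (fun t => prefixInd u (t ++ r)) B := by
  induction B with
  | nil => simp [tailSum]
  | cons x B ih =>
    rw [List.length_cons, List.range_succ_eq_map, List.map_cons, List.map_map, List.count_cons,
      tailSum, ← ih]
    simp only [List.cons_append, List.drop_zero, Nat.cast_add, prefixInd,
      List.prefix_iff_eq_take, beq_iff_eq]
    rw [add_comm]
    congr 1
    rw [Nat.cast_ite]
    exact if_congr eq_comm (by simp) (by simp)

end TailSum

section Induce

variable {m : ℕ} {p : Fin (m + 1) → ℝ}

/-- The expected sum of `F` over the suffixes of `ζ_m(w)` that start in the image of the first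
letter of `w`. On functions of the first `ℓ` letters this is the transpose of
`inducedMatrix m p ℓ`. -/
def induce (p : Fin (m + 1) → ℝ) (F : List Letter → ℝ) : List Letter → ℝ
  | [] => 0
  | x :: z => ∑ i, p i * expect p (fun v => tailSum (fun t => F (t ++ v)) (nms m i x)) z

theorem expect_tailSum (P : IsPosProb p) (F : List Letter → ℝ) (z : List Letter) :
    expect p (tailSum F) z = tailSum (induce p F) z := by
  induction z with
  | nil => simp [expect, tailSum]
  | cons x z ih =>
    simp only [expect, tailSum, induce, tailSum_append, expect_add, ih, mul_add,
      Finset.sum_add_distrib, ← Finset.sum_mul, P.sum_eq_one, one_mul]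

theorem iterate_expect_tailSum (P : IsPosProb p) (k : ℕ) (F : List Letter → ℝ) :
    (expect p)^[k] (tailSum F) = tailSum ((induce p)^[k] F) := by
  induction k generalizing F with
  | zero => rfl
  | succ k ih =>
    rw [Function.iterate_succ_apply, Function.iterate_succ_apply, ← ih]
    congr 1
    exact funext (expect_tailSum P F)

theorem iterate_induce_cons (P : IsPosProb p) (k : ℕ) (F : List Letter → ℝ) (x : Letter)
    (z : List Letter) :
    (induce p)^[k] F (x :: z) =
      (expect p)^[k] (tailSum F) (x :: z) - (expect p)^[k] (tailSum F) z := by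
  simp [iterate_expect_tailSum P, tailSum]

theorem iterate_induce_cons_eq_expect (P : IsPosProb p) (k : ℕ) (F : List Letter → ℝ) (x : Letter)
    (z : List Letter) :
    (induce p)^[k] F (x :: z) = (expect p)^[k] (fun B =>
      (expect p)^[k] (fun v => tailSum (fun t => F (t ++ v)) B) z) [x] := by
  rw [iterate_induce_cons P, ← List.singleton_append, iterate_expect_append]
  simp only [tailSum_append, iterate_expect_add, iterate_expect_const P]
  ring

theorem isLocal_induce (P : IsPosProb p) {n : ℕ} (hn : 1 ≤ n) {F : List Letter → ℝ}
    (hF : IsLocal n F) : IsLocal n (induce p F) := by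
  intro s t hs
  cases s with
  | nil => exact absurd (hn.trans hs) (by simp)
  | cons x s =>
    simp only [List.cons_append, induce]
    refine Finset.sum_congr rfl fun i _ => ?_
    congr 1
    rw [expect_append]
    refine iterate_expect_congr P (k := 1) fun v₁ hv₁ =>
      iterate_expect_eq_const P (k := 1) fun v₂ _ => tailSum_congr fun r hr _ => ?_
    rw [← List.append_assoc]
    refine hF _ _ ?_
    have hlen := hv₁.length_le
    have hpos := List.length_pos_of_ne_nil hr
    rw [List.length_cons] at hs
    rw [List.length_append]
    omega

theorem isLocal_iterate_induce (P : IsPosProb p) {n : ℕ} (hn : 1 ≤ n) {F : List Letter → ℝ}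
    (hF : IsLocal n F) (k : ℕ) : IsLocal n ((induce p)^[k] F) := by
  induction k with
  | zero => exact hF
  | succ k ih =>
    rw [Function.iterate_succ_apply']
    exact isLocal_induce P hn ih

theorem induce_congr (P : IsPosProb p) {n : ℕ} {F F' : List Letter → ℝ}
    (h : ∀ t, IsLegal m t → n ≤ t.length → F t = F' t) {z : List Letter} (hz : IsLegal m z)
    (hn : n ≤ z.length) : induce p F z = induce p F' z := by
  cases z with
  | nil => rfl
  | cons x z =>
    simp only [induce]
    refine Finset.sum_congr rfl fun i _ => ?_
    congr 1
    refine iterate_expect_congr P (k := 1) fun v hv => ?_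
    refine tailSum_congr fun r hr hr' => h _ ?_ ?_
    · have himage : IsIterImage m 1 (x :: z) (nms m i x ++ v) :=
        isIterImage_one.2 (isImage_cons.2 ⟨i, v, isIterImage_one.1 hv, rfl⟩)
      obtain ⟨s, hs⟩ := hr'
      exact (hz.isIterImage himage).infix ⟨s, [], by rw [← hs]; simp⟩
    · have hlen := hv.length_le
      have hpos := List.length_pos_of_ne_nil hr
      rw [List.length_cons] at hn
      rw [List.length_append]
      omega

theorem induce_sum {ι : Type*} (s : Finset ι) (c : ι → ℝ) (F : ι → List Letter → ℝ)
    (z : List Letter) :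
    induce p (fun t => ∑ j ∈ s, c j * F j t) z = ∑ j ∈ s, c j * induce p (F j) z := by
  cases z with
  | nil => simp [induce]
  | cons x z =>
    simp only [induce, tailSum_sum, tailSum_const_mul, expect_sum, expect_const_mul, Finset.mul_sum]
    rw [Finset.sum_comm]
    simp only [mul_left_comm]

theorem inducedMatrix_apply {ℓ : ℕ} (hℓ : 1 ≤ ℓ) (u w : LegalWord m ℓ) :
    inducedMatrix m p ℓ u w = induce p (prefixInd (List.ofFn u.1)) (List.ofFn w.1) := by
  obtain ⟨n, rfl⟩ : ∃ n, ℓ = n + 1 := ⟨ℓ - 1, by omega⟩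
  obtain ⟨w, hw⟩ := w
  obtain ⟨u, hu⟩ := u
  simp only [inducedMatrix, List.ofFn_succ (f := w), induce]
  rw [← (Fin.consEquiv fun _ => Fin (m + 1)).sum_comp, Fintype.sum_prod_type]
  refine Finset.sum_congr rfl fun i _ => ?_
  rw [← sum_choices, Finset.mul_sum]
  refine Finset.sum_congr rfl fun c _ => ?_
  rw [← count_take_drop]
  simp [Fin.prod_univ_succ, letterImages, List.ofFn_succ, mul_assoc, inducedImage]

theorem IsLocal.eq_sum_prefixInd {ℓ : ℕ} {F : List Letter → ℝ} (hF : IsLocal ℓ F) {t : List Letter}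
    (ht : IsLegal m t) (hℓ : ℓ ≤ t.length) :
    F t = ∑ u : LegalWord m ℓ, F (List.ofFn u.1) * prefixInd (List.ofFn u.1) t := by
  have hlen : (t.take ℓ).length = ℓ := by simp [hℓ]
  obtain ⟨f, hf⟩ : ∃ f : Fin ℓ → Letter, List.ofFn f = t.take ℓ := by
    refine ⟨fun j => (t.take ℓ).get (j.cast hlen.symm), List.ext_getElem (by simp [hlen]) ?_⟩
    simp
  have hleg : IsLegal m (List.ofFn f) := hf ▸ ht.infix (List.take_prefix _ _).isInfix
  rw [Finset.sum_eq_single (⟨f, hleg⟩ : LegalWord m ℓ)]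
  · rw [prefixInd, if_pos (hf ▸ List.take_prefix _ _), mul_one]
    exact (hf ▸ hF.take hℓ).symm
  · intro u _ hu
    rw [prefixInd, if_neg, mul_zero]
    intro h
    refine hu (Subtype.ext (List.ofFn_injective ?_))
    rw [List.prefix_iff_eq_take, List.length_ofFn] at h
    rw [h, hf]
  · simp

theorem induce_eq_sum (P : IsPosProb p) {ℓ : ℕ} (hℓ : 1 ≤ ℓ) {F : List Letter → ℝ}
    (hF : IsLocal ℓ F) (w : LegalWord m ℓ) :
    induce p F (List.ofFn w.1) =
      ∑ u : LegalWord m ℓ, F (List.ofFn u.1) * inducedMatrix m p ℓ u w := by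
  simp only [inducedMatrix_apply hℓ, ← induce_sum]
  exact induce_congr P (fun _ ht h => hF.eq_sum_prefixInd ht h) w.2 (by simp)

end Induce

section Recursion

variable {a l : ℝ} {α e : ℕ → ℝ}

theorem abs_sub_le_of_recursion (hl : 1 < l) (hsq : l * l = a * l + 1) {C : ℝ}
    (h : ∀ k, α (k + 2) = a * α (k + 1) + α k + e k) (he : ∀ k, |e k| ≤ C) (k : ℕ) :
    |α (k + 1) - l * α k| ≤ max |α 1 - l * α 0| (C / (1 - l⁻¹)) := by
  have hl0 : 0 < l := one_pos.trans hl
  set D := max |α 1 - l * α 0| (C / (1 - l⁻¹))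
  have hD : D * l⁻¹ + C ≤ D := by
    have hC : C / (1 - l⁻¹) ≤ D := le_max_right _ _
    rw [div_le_iff₀ (sub_pos.2 (inv_lt_one_of_one_lt₀ hl))] at hC
    linarith
  induction k with
  | zero => exact le_max_left _ _
  | succ k ih =>
    have hstep : α (k + 2) - l * α (k + 1) = -((α (k + 1) - l * α k) * l⁻¹) + e k := by
      rw [h]
      field_simp
      linear_combination (-α (k + 1)) * hsq
    calc |α (k + 2) - l * α (k + 1)| ≤ |α (k + 1) - l * α k| * l⁻¹ + |e k| := by
          rw [hstep, ← abs_of_pos (inv_pos.2 hl0), ← abs_mul, abs_of_pos (inv_pos.2 hl0),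
            ← abs_neg ((α (k + 1) - l * α k) * l⁻¹)]
          exact abs_add_le _ _
      _ ≤ D * l⁻¹ + C := by gcongr; exact he k
      _ ≤ D := hD

theorem exists_tendsto_of_recursion (hl : 1 < l) (hsq : l * l = a * l + 1) {C : ℝ}
    (h : ∀ k, α (k + 2) = a * α (k + 1) + α k + e k) (he : ∀ k, |e k| ≤ C) :
    ∃ c, Tendsto (fun k => α k / l ^ k) atTop (𝓝 c) := by
  have : 0 < l := one_pos.trans hl
  set D := max |α 1 - l * α 0| (C / (1 - l⁻¹))
  refine cauchySeq_tendsto_of_complete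
    (cauchySeq_of_le_geometric l⁻¹ (D * l⁻¹) (inv_lt_one_of_one_lt₀ hl) fun k => ?_)
  have hstep : α k / l ^ k - α (k + 1) / l ^ (k + 1) =
      -(α (k + 1) - l * α k) * (l⁻¹ * l⁻¹ ^ k) := by
    rw [pow_succ, inv_pow]
    field_simp
    ring
  have hpos : 0 < l⁻¹ * l⁻¹ ^ k := by positivity
  rw [Real.dist_eq, hstep, abs_mul, abs_neg, mul_assoc, abs_of_pos hpos]
  exact mul_le_mul_of_nonneg_right (abs_sub_le_of_recursion hl hsq h he k) hpos.le

theorem pos_of_recursion (hl : 0 < l) (hsq : l * l = a * l + 1) {c : ℝ}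
    (h : ∀ k, α (k + 2) = a * α (k + 1) + α k + e k) (he : ∀ k, 0 ≤ e k) (hα : ∀ k, 0 ≤ α k)
    (hpos : ∃ k, 0 < α k) (hc : Tendsto (fun k => α k / l ^ k) atTop (𝓝 c)) : 0 < c := by
  obtain ⟨j, hj⟩ := hpos
  -- `(l, l⁻¹)` is the left eigenvector of the recursion for the eigenvalue `l`.
  let b : ℕ → ℝ := fun k => l * (α (k + 1) / l ^ (k + 1)) + l⁻¹ * (α k / l ^ k)
  have hmono : Monotone b := by
    refine monotone_nat_of_le_succ fun k => sub_nonneg.1 ?_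
    have hstep : b (k + 1) - b k = e k / l ^ (k + 1) := by
      simp only [b, h, pow_succ]
      field_simp
      linear_combination (-α (k + 1)) * hsq
    rw [hstep]
    exact div_nonneg (he k) (by positivity)
  have hlim : Tendsto b atTop (𝓝 (l * c + l⁻¹ * c)) :=
    (((tendsto_add_atTop_iff_nat 1).2 hc).const_mul l).add (hc.const_mul l⁻¹)
  have hb : 0 < b j := by
    have := hα (j + 1)
    positivity
  have hle : b j ≤ (l + l⁻¹) * c := add_mul l l⁻¹ c ▸ hmono.ge_of_tendsto hlim j
  exact pos_of_mul_pos_right (hb.trans_le hle) (by positivity)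

end Recursion

section Inflation

variable {m : ℕ}

/-- The inflation factor of `ζ_m`: the larger root of `x² = m x + 1`, and the common growth rate of
the lengths `|ζ_m^k(x)|`. -/
def inflation (m : ℕ) : ℝ := (m + √((m : ℝ) ^ 2 + 4)) / 2

theorem inflation_mul_self (m : ℕ) : inflation m * inflation m = m * inflation m + 1 := by
  have h : √((m : ℝ) ^ 2 + 4) * √((m : ℝ) ^ 2 + 4) = (m : ℝ) ^ 2 + 4 :=
    Real.mul_self_sqrt (by positivity)
  unfold inflation
  linear_combination h / 4

theorem one_lt_inflation (hm : 1 ≤ m) : 1 < inflation m := by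
  have hm' : (1 : ℝ) ≤ m := by exact_mod_cast hm
  have h : 1 < √((m : ℝ) ^ 2 + 4) := by
    rw [Real.lt_sqrt zero_le_one]
    nlinarith
  unfold inflation
  linarith

theorem inflation_pos (m : ℕ) : 0 < inflation m := by
  unfold inflation
  positivity

theorem imageLen_add_two_a (k : ℕ) : (imageLen m (k + 2) Letter.a : ℝ) =
    m * imageLen m (k + 1) Letter.a + imageLen m k Letter.a := by
  rw [imageLen, imageLen.eq_3]
  push_cast
  rfl

theorem exists_tendsto_imageLen (hm : 1 ≤ m) : ∃ c : ℝ, 0 < c ∧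
    Tendsto (fun k => (imageLen m k Letter.a : ℝ) / inflation m ^ k) atTop (𝓝 c) := by
  have hrec : ∀ k, (imageLen m (k + 2) Letter.a : ℝ) =
      m * imageLen m (k + 1) Letter.a + imageLen m k Letter.a + 0 := by
    simpa only [add_zero] using imageLen_add_two_a
  obtain ⟨c, hc⟩ := exists_tendsto_of_recursion (α := fun k => (imageLen m k Letter.a : ℝ))
    (one_lt_inflation hm) (inflation_mul_self m) hrec (fun _ => abs_zero.le)
  exact ⟨c, pos_of_recursion (e := fun _ => 0) (inflation_pos m) (inflation_mul_self m) hrec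
    (fun _ => le_rfl) (fun _ => Nat.cast_nonneg _) ⟨0, by simp [imageLen]⟩ hc, hc⟩

theorem tendsto_imageLen_ratio (hm : 1 ≤ m) :
    Tendsto (fun k => (imageLen m (k + 1) Letter.a : ℝ) / imageLen m k Letter.a) atTop
      (𝓝 (inflation m)) := by
  obtain ⟨c, hc, hlim⟩ := exists_tendsto_imageLen hm
  have h := (((tendsto_add_atTop_iff_nat 1).2 hlim).div hlim hc.ne').mul_const (inflation m)
  rw [div_self hc.ne', one_mul] at h
  refine h.congr fun k => ?_
  have := imageLen_pos (m := m) k Letter.a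
  have := inflation_pos m
  simp only [Pi.div_apply, pow_succ]
  field_simp

theorem tendsto_imageLen_atTop (hm : 1 ≤ m) :
    Tendsto (fun k => (imageLen m k Letter.a : ℝ)) atTop atTop :=
  tendsto_atTop_mono (fun k => by exact_mod_cast (lt_imageLen_a hm k).le)
    tendsto_natCast_atTop_atTop

theorem div_pow_div_imageLen_div_pow (x : ℝ) (k : ℕ) :
    x / inflation m ^ k / (imageLen m k Letter.a / inflation m ^ k) =
      x / imageLen m k Letter.a :=
  div_div_div_cancel_right₀ (pow_pos (inflation_pos m) k).ne' _ _

theorem tendsto_div_imageLen_of_abs_sub_le (hm : 1 ≤ m) {α β : ℕ → ℝ} {c C : ℝ}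
    (h : ∀ k, |α k - β k| ≤ C)
    (hα : Tendsto (fun k => α k / imageLen m k Letter.a) atTop (𝓝 c)) :
    Tendsto (fun k => β k / imageLen m k Letter.a) atTop (𝓝 c) := by
  refine hα.congr_dist (squeeze_zero (fun _ => dist_nonneg) (fun k => ?_)
    ((tendsto_imageLen_atTop hm).const_div_atTop C))
  rw [Real.dist_eq, ← sub_div, abs_div, Nat.abs_cast]
  gcongr
  exact h k

end Inflation

section Freq

variable {m : ℕ} {p : Fin (m + 1) → ℝ}

theorem iterate_expect_succ_b (P : IsPosProb p) (k : ℕ) (g : List Letter → ℝ) :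
    (expect p)^[k + 1] g [Letter.b] = (expect p)^[k] g [Letter.a] := by
  simp [Function.iterate_succ_apply', expect, nms, ← Finset.sum_mul, P.sum_eq_one]

theorem iterate_expect_occ_append_ge (P : IsPosProb p) (k : ℕ) (u w₁ w₂ : List Letter) :
    (expect p)^[k] (occ u) w₁ + (expect p)^[k] (occ u) w₂ ≤ (expect p)^[k] (occ u) (w₁ ++ w₂) := by
  rw [iterate_expect_append]
  calc _ = (expect p)^[k] (fun v₁ => (expect p)^[k] (fun v₂ => occ u v₁ + occ u v₂) w₂) w₁ := by
        simp only [iterate_expect_add, iterate_expect_const P]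
    _ ≤ _ := iterate_expect_mono P fun v₁ _ => iterate_expect_mono P fun v₂ _ => occ_add_le u v₁ v₂

theorem iterate_expect_occ_append_le (P : IsPosProb p) (k : ℕ) (u w₁ w₂ : List Letter) :
    (expect p)^[k] (occ u) (w₁ ++ w₂) ≤
      (expect p)^[k] (occ u) w₁ + (expect p)^[k] (occ u) w₂ + u.length := by
  rw [iterate_expect_append]
  calc _ ≤ (expect p)^[k] (fun v₁ => (expect p)^[k]
          (fun v₂ => occ u v₁ + occ u v₂ + u.length) w₂) w₁ :=
        iterate_expect_mono P fun v₁ _ => iterate_expect_mono P fun v₂ _ => occ_append_le u v₁ v₂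
    _ = _ := by simp only [iterate_expect_add, iterate_expect_const P]

theorem iterate_expect_occ_bounds (P : IsPosProb p) (k : ℕ) (u w : List Letter) :
    (w.map fun x => (expect p)^[k] (occ u) [x]).sum ≤ (expect p)^[k] (occ u) w ∧
      (expect p)^[k] (occ u) w ≤
        (w.map fun x => (expect p)^[k] (occ u) [x]).sum + u.length * w.length := by
  induction w with
  | nil => simp [iterate_expect_nil, occ, tailSum]
  | cons x w ih =>
    have h₁ := iterate_expect_occ_append_ge P k u [x] w
    have h₂ := iterate_expect_occ_append_le P k u [x] w
    rw [List.singleton_append] at h₁ h₂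
    simp only [List.map_cons, List.sum_cons, List.length_cons]
    push_cast
    constructor <;> linarith

theorem sum_map_nms_a (f : Letter → ℝ) (i : Fin (m + 1)) :
    ((nms m i Letter.a).map f).sum = m * f Letter.a + f Letter.b := by
  have hi : (i : ℕ) + ((m - i : ℕ) : ℝ) = m := by
    rw [Nat.cast_sub (by omega)]
    ring
  simp only [nms, List.map_append, List.map_cons, List.map_replicate, List.sum_append,
    List.sum_cons, List.sum_replicate, nsmul_eq_mul]
  linear_combination (f Letter.a) * hi

theorem length_nms_a (i : Fin (m + 1)) : (nms m i Letter.a).length = m + 1 := by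
  simp only [nms, List.length_append, List.length_replicate, List.length_cons]
  omega

theorem exists_occ_recursion (P : IsPosProb p) (u : List Letter) :
    ∃ e : ℕ → ℝ, (∀ k, 0 ≤ e k ∧ e k ≤ u.length * (m + 1)) ∧
      ∀ k, (expect p)^[k + 2] (occ u) [Letter.a] = m * (expect p)^[k + 1] (occ u) [Letter.a] +
        (expect p)^[k] (occ u) [Letter.a] + e k := by
  set α : ℕ → ℝ := fun k => (expect p)^[k] (occ u) [Letter.a]
  have hbound : ∀ k v, IsIterImage m 1 [Letter.a] v →
      m * α (k + 1) + α k ≤ (expect p)^[k + 1] (occ u) v ∧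
        (expect p)^[k + 1] (occ u) v ≤ m * α (k + 1) + α k + u.length * (m + 1) := by
    intro k v hv
    obtain ⟨i, v', hv', rfl⟩ := isImage_cons.1 (isIterImage_one.1 hv)
    obtain rfl := isImage_nil.1 hv'
    have h := iterate_expect_occ_bounds P (k + 1) u (nms m i Letter.a)
    rw [sum_map_nms_a, iterate_expect_succ_b P, length_nms_a] at h
    rw [List.append_nil]
    exact_mod_cast h
  refine ⟨fun k => α (k + 2) - (m * α (k + 1) + α k), fun k => ?_, fun k => by ring⟩
  have hsplit : α (k + 2) = (expect p)^[1] ((expect p)^[k + 1] (occ u)) [Letter.a] := by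
    rw [← Function.iterate_add_apply, Nat.add_comm 1]
  have hge := iterate_expect_mono P fun v hv => (hbound k v hv).1
  have hle := iterate_expect_mono P fun v hv => (hbound k v hv).2
  rw [iterate_expect_const P, ← hsplit] at hge hle
  constructor <;> linarith

/-- The frequency of the word `u`: the limit of the expected number of occurrences of `u` in
`ζ_m^k(a)` per letter. The limit exists by `tendsto_freq`. -/
def freq (p : Fin (m + 1) → ℝ) (u : List Letter) : ℝ :=
  limUnder atTop fun k => (expect p)^[k] (occ u) [Letter.a] / imageLen m k Letter.a

theorem exists_tendsto_occ (hm : 1 ≤ m) (P : IsPosProb p) (u : List Letter) : ∃ c,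
    Tendsto (fun k => (expect p)^[k] (occ u) [Letter.a] / inflation m ^ k) atTop (𝓝 c) := by
  obtain ⟨e, he, hrec⟩ := exists_occ_recursion P u
  exact exists_tendsto_of_recursion (one_lt_inflation hm) (inflation_mul_self m) hrec
    fun k => (abs_of_nonneg (he k).1).trans_le (he k).2

theorem tendsto_freq (hm : 1 ≤ m) (P : IsPosProb p) (u : List Letter) :
    Tendsto (fun k => (expect p)^[k] (occ u) [Letter.a] / imageLen m k Letter.a) atTop
      (𝓝 (freq p u)) := by
  obtain ⟨c, hc⟩ := exists_tendsto_occ hm P u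
  obtain ⟨d, hd, hlim⟩ := exists_tendsto_imageLen hm
  exact tendsto_nhds_limUnder
    ⟨c / d, (hc.div hlim hd.ne').congr fun k => div_pow_div_imageLen_div_pow _ k⟩

theorem freq_pos (hm : 1 ≤ m) (P : IsPosProb p) {u : List Letter} (hu : u ≠ []) (h : IsLegal m u) :
    0 < freq p u := by
  obtain ⟨e, he, hrec⟩ := exists_occ_recursion P u
  obtain ⟨c, hc⟩ := exists_tendsto_occ hm P u
  obtain ⟨d, hd, hlim⟩ := exists_tendsto_imageLen hm
  have hoccurs : ∃ k, 0 < (expect p)^[k] (occ u) [Letter.a] := by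
    obtain ⟨k, hk, v, hv, huv⟩ := h
    obtain ⟨k, rfl⟩ : ∃ j, k = j + 1 := ⟨k - 1, by omega⟩
    exact ⟨k, iterate_expect_pos P (occ_nonneg u) (isIterImage_succ_b.1 hv) (occ_pos hu huv)⟩
  have hc0 : 0 < c := pos_of_recursion (inflation_pos m) (inflation_mul_self m) hrec
    (fun k => (he k).1) (fun k => iterate_expect_nonneg P (occ_nonneg u)) hoccurs hc
  rw [tendsto_nhds_unique (tendsto_freq hm P u)
    ((hc.div hlim hd.ne').congr fun k => div_pow_div_imageLen_div_pow _ k)]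
  exact div_pos hc0 hd

theorem IsLocal.abs_sum_occ_sub_tailSum_le {ℓ : ℕ} {F : List Letter → ℝ} (hF : IsLocal ℓ F) {C : ℝ}
    (hC : ∀ t, |F t| ≤ C) {v : List Letter} (hv : IsLegal m v) :
    |∑ u : LegalWord m ℓ, F (List.ofFn u.1) * occ (List.ofFn u.1) v - tailSum F v| ≤ ℓ * C := by
  have hsum : ∑ u : LegalWord m ℓ, F (List.ofFn u.1) * occ (List.ofFn u.1) v - tailSum F v =
      tailSum (fun t => ∑ u : LegalWord m ℓ, F (List.ofFn u.1) * prefixInd (List.ofFn u.1) t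
        - F t) v := by
    simp only [tailSum_sub, tailSum_sum, tailSum_const_mul, occ]
  have hshort : ∀ t : List Letter, t.length < ℓ →
      ∑ u : LegalWord m ℓ, F (List.ofFn u.1) * prefixInd (List.ofFn u.1) t = 0 := by
    refine fun t ht => Finset.sum_eq_zero fun u _ => ?_
    rw [prefixInd, if_neg, mul_zero]
    intro h
    have hlen := h.length_le
    rw [List.length_ofFn] at hlen
    omega
  have hC0 : 0 ≤ C := (abs_nonneg _).trans (hC [])
  rw [hsum]
  refine (abs_tailSum_le (n := ℓ) (C := C) (fun t ht hn => ?_) fun t ht => ?_).trans ?_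
  · rw [← hF.eq_sum_prefixInd (hv.infix ht.isInfix) hn, sub_self]
  · rw [hshort t ht, zero_sub, abs_neg]
    exact hC t
  · gcongr
    exact min_le_right _ _

theorem tendsto_tailSum (hm : 1 ≤ m) (P : IsPosProb p) {ℓ : ℕ} {F : List Letter → ℝ}
    (hF : IsLocal ℓ F) {C : ℝ} (hC : ∀ t, |F t| ≤ C) :
    Tendsto (fun k => (expect p)^[k] (tailSum F) [Letter.a] / imageLen m k Letter.a) atTop
      (𝓝 (∑ u : LegalWord m ℓ, F (List.ofFn u.1) * freq p (List.ofFn u.1))) := by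
  refine tendsto_div_imageLen_of_abs_sub_le hm (fun k => abs_iterate_expect_sub_le P
    fun v hv => hF.abs_sum_occ_sub_tailSum_le hC hv.isLegal) ?_
  simp only [iterate_expect_sum, iterate_expect_const_mul, Finset.sum_div, mul_div_assoc]
  exact tendsto_finsetSum _ fun u _ => (tendsto_freq hm P _).const_mul _

theorem sum_freq (hm : 1 ≤ m) (P : IsPosProb p) (ℓ : ℕ) :
    ∑ u : LegalWord m ℓ, freq p (List.ofFn u.1) = 1 := by
  have h := tendsto_tailSum hm P (ℓ := ℓ) (F := fun _ => 1) (fun _ _ _ => rfl) (C := 1) (by simp)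
  simp only [one_mul] at h
  refine tendsto_nhds_unique h (tendsto_const_nhds.congr fun k => ?_)
  have hlen : (expect p)^[k] (tailSum fun _ => 1) [Letter.a] = imageLen m k Letter.a :=
    iterate_expect_eq_const P fun v hv => by simp [tailSum_const, hv.length_eq]
  rw [hlen, div_self (by exact_mod_cast (imageLen_pos k Letter.a).ne')]

end Freq

section Eigenvector

theorem norm_le_of_pos_eigenvector {ι : Type*} [Fintype ι] {M : Matrix ι ι ℝ} {R : ι → ℝ} {r : ℝ}
    (hM : ∀ i j, 0 ≤ M i j) (hR : ∀ i, 0 < R i) (h : M.mulVec R = r • R) {z : ℂ} {x : ι → ℂ}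
    (hx : x ≠ 0) (hz : (M.map Complex.ofReal).mulVec x = z • x) : ‖z‖ ≤ r := by
  obtain ⟨i₀, hi₀⟩ := Function.ne_iff.1 hx
  obtain ⟨i, -, hi⟩ := Finset.exists_max_image Finset.univ (fun i => ‖x i‖ / R i)
    ⟨i₀, Finset.mem_univ _⟩
  set t := ‖x i‖ / R i with ht
  have hxt : ∀ j, ‖x j‖ ≤ t * R j := fun j => (div_le_iff₀ (hR j)).1 (hi j (Finset.mem_univ j))
  have ht0 : 0 < t := (div_pos (norm_pos_iff.2 hi₀) (hR _)).trans_le (hi i₀ (Finset.mem_univ _))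
  have hxi : ‖x i‖ = t * R i := by rw [ht, div_mul_cancel₀ _ (hR i).ne']
  have hle : ‖z‖ * ‖x i‖ ≤ t * (r * R i) := by
    have hzi := congrFun hz i
    have hri := congrFun h i
    simp only [Matrix.mulVec, dotProduct, Matrix.map_apply, Pi.smul_apply, smul_eq_mul] at hzi hri
    rw [← norm_mul, ← hzi, ← hri, Finset.mul_sum]
    refine (norm_sum_le _ _).trans (Finset.sum_le_sum fun j _ => ?_)
    rw [norm_mul, Complex.norm_real, Real.norm_of_nonneg (hM i j), mul_left_comm]
    exact mul_le_mul_of_nonneg_left (hxt j) (hM i j)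
  rw [hxi, mul_left_comm] at hle
  exact le_of_mul_le_mul_right (le_of_mul_le_mul_left hle ht0) (hR i)

theorem abs_le_of_pos_eigenvector {ι : Type*} [Fintype ι] {M : Matrix ι ι ℝ} {R : ι → ℝ} {r : ℝ}
    (hM : ∀ i j, 0 ≤ M i j) (hR : ∀ i, 0 < R i) (h : M.mulVec R = r • R) {s : ℝ} {x : ι → ℝ}
    (hx : x ≠ 0) (hs : M.mulVec x = s • x) : |s| ≤ r := by
  rw [← Real.norm_eq_abs, ← Complex.norm_real]
  refine norm_le_of_pos_eigenvector (x := fun i => (x i : ℂ)) hM hR h ?_ ?_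
  · exact fun h₀ => hx (funext fun i => Complex.ofReal_eq_zero.1 (congrFun h₀ i))
  · funext i
    simpa [Matrix.mulVec, dotProduct] using congrArg Complex.ofReal (congrFun hs i)

theorem IsRightPF.ne_zero {ι : Type*} [Fintype ι] {M : Matrix ι ι ℝ} {R : ι → ℝ}
    (h : IsRightPF M R) : R ≠ 0 := by
  rintro rfl
  simpa using h.2.1

variable {m : ℕ} {p : Fin (m + 1) → ℝ}

theorem abs_induce_prefixInd_le (P : IsPosProb p) (u t : List Letter) :
    |induce p (prefixInd u) t| ≤ m + 1 := by
  cases t with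
  | nil =>
    rw [induce, abs_zero]
    positivity
  | cons x z =>
    have h := iterate_induce_cons_eq_expect P 1 (prefixInd u) x z
    rw [Function.iterate_one] at h
    rw [h, abs_of_nonneg]
    · refine iterate_expect_le_const P fun B hB => iterate_expect_le_const P fun v _ => ?_
      refine (tailSum_mono fun t _ _ => prefixInd_le_one u _).trans ?_
      rw [tailSum_const, hB.length_eq, mul_one]
      cases x <;> simp [imageLen]
    · exact iterate_expect_nonneg P fun B => iterate_expect_nonneg P fun v =>
        tailSum_nonneg (fun t => prefixInd_nonneg u _) _

theorem inducedMatrix_mulVec_freq (hm : 1 ≤ m) (P : IsPosProb p) {ℓ : ℕ} (hℓ : 1 ≤ ℓ) :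
    (inducedMatrix m p ℓ).mulVec (fun w => freq p (List.ofFn w.1)) =
      inflation m • fun w : LegalWord m ℓ => freq p (List.ofFn w.1) := by
  funext u
  have hloc : IsLocal ℓ (induce p (prefixInd (List.ofFn u.1))) := by
    simpa using isLocal_induce P (by simpa using hℓ) (isLocal_prefixInd (List.ofFn u.1))
  have hinduce := tendsto_tailSum hm P hloc (abs_induce_prefixInd_le P _)
  have hnext := ((tendsto_add_atTop_iff_nat 1).2 (tendsto_freq hm P (List.ofFn u.1))).mul
    (tendsto_imageLen_ratio hm)
  simp only [Matrix.mulVec, dotProduct, inducedMatrix_apply hℓ, Pi.smul_apply, smul_eq_mul]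
  rw [mul_comm]
  refine tendsto_nhds_unique hinduce (hnext.congr fun k => ?_)
  have := imageLen_pos (m := m) k Letter.a
  have := imageLen_pos (m := m) (k + 1) Letter.a
  rw [Function.iterate_succ_apply, show expect p (occ (List.ofFn u.1)) =
    tailSum (induce p (prefixInd (List.ofFn u.1))) from funext (expect_tailSum P _)]
  field_simp

theorem inducedMatrix_nonneg (P : IsPosProb p) (ℓ : ℕ) (u w : LegalWord m ℓ) :
    0 ≤ inducedMatrix m p ℓ u w :=
  Finset.sum_nonneg fun _ _ =>
    mul_nonneg (Finset.prod_nonneg fun _ _ => (P.pos _).le) (Nat.cast_nonneg _)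

theorem freq_ofFn_pos (hm : 1 ≤ m) (P : IsPosProb p) {ℓ : ℕ} (hℓ : 1 ≤ ℓ) (w : LegalWord m ℓ) :
    0 < freq p (List.ofFn w.1) :=
  freq_pos hm P (by rw [Ne, List.ofFn_eq_nil_iff]; omega) w.2

theorem isRightPF_freq (hm : 1 ≤ m) (P : IsPosProb p) {ℓ : ℕ} (hℓ : 1 ≤ ℓ) :
    IsRightPF (inducedMatrix m p ℓ) fun w => freq p (List.ofFn w.1) :=
  ⟨freq_ofFn_pos hm P hℓ, sum_freq hm P ℓ, inflation m, inducedMatrix_mulVec_freq hm P hℓ,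
    fun _ _ hx hz => norm_le_of_pos_eigenvector (inducedMatrix_nonneg P ℓ) (freq_ofFn_pos hm P hℓ)
      (inducedMatrix_mulVec_freq hm P hℓ) hx hz⟩

theorem sum_mul_iterate_induce (P : IsPosProb p) {ℓ : ℕ} (hℓ : 1 ≤ ℓ) {R : LegalWord m ℓ → ℝ}
    {r : ℝ} (h : (inducedMatrix m p ℓ).mulVec R = r • R) {F : List Letter → ℝ}
    (hF : IsLocal ℓ F) (k : ℕ) :
    ∑ w, R w * (induce p)^[k] F (List.ofFn w.1) = r ^ k * ∑ w, R w * F (List.ofFn w.1) := by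
  induction k with
  | zero => simp
  | succ k ih =>
    rw [pow_succ', mul_assoc, ← ih, Function.iterate_succ_apply']
    simp only [induce_eq_sum P hℓ (isLocal_iterate_induce P hℓ hF k), Finset.mul_sum]
    rw [Finset.sum_comm]
    refine Finset.sum_congr rfl fun u _ => ?_
    have hu := congrFun h u
    simp only [Matrix.mulVec, dotProduct, Pi.smul_apply, smul_eq_mul] at hu
    rw [← mul_assoc, ← hu, Finset.sum_mul]
    exact Finset.sum_congr rfl fun w _ => by ring

theorem sum_mul_prefixInd {ℓ : ℕ} (R : LegalWord m ℓ → ℝ) (u : LegalWord m ℓ) :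
    ∑ w, R w * prefixInd (List.ofFn u.1) (List.ofFn w.1) = R u := by
  rw [Finset.sum_eq_single u]
  · simp [prefixInd]
  · intro w _ hw
    rw [prefixInd, if_neg, mul_zero]
    exact fun h => hw (Subtype.ext (List.ofFn_injective (h.eq_of_length (by simp)).symm))
  · simp

theorem abs_iterate_induce_sub_le (P : IsPosProb p) (k : ℕ) (u : List Letter) (x : Letter)
    (z : List Letter) :
    |(induce p)^[k] (prefixInd u) (x :: z) - (expect p)^[k] (occ u) [x]| ≤ u.length := by
  have hge := iterate_expect_occ_append_ge P k u [x] z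
  have hle := iterate_expect_occ_append_le P k u [x] z
  have hlen : (0 : ℝ) ≤ u.length := Nat.cast_nonneg _
  rw [List.singleton_append] at hge hle
  rw [iterate_induce_cons P, ← occ, abs_le]
  constructor <;> linarith

/-- The limit of `|ζ_m^k(x)| / |ζ_m^k(a)|`. -/
def relLen (m : ℕ) : Letter → ℝ
  | Letter.a => 1
  | Letter.b => (inflation m)⁻¹

theorem tendsto_occ_letter (hm : 1 ≤ m) (P : IsPosProb p) (x : Letter) (u : List Letter) :
    Tendsto (fun k => (expect p)^[k] (occ u) [x] / imageLen m k Letter.a) atTop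
      (𝓝 (relLen m x * freq p u)) := by
  cases x with
  | a => simpa [relLen] using tendsto_freq hm P u
  | b =>
    rw [← tendsto_add_atTop_iff_nat 1]
    refine (((tendsto_imageLen_ratio hm).inv₀ (inflation_pos m).ne').mul
      (tendsto_freq hm P u)).congr fun k => ?_
    have := imageLen_pos (m := m) k Letter.a
    rw [iterate_expect_succ_b P]
    field_simp

theorem tendsto_iterate_induce_prefixInd (hm : 1 ≤ m) (P : IsPosProb p) (u : List Letter)
    (x : Letter) (z : List Letter) :
    Tendsto (fun k => (induce p)^[k] (prefixInd u) (x :: z) / imageLen m k Letter.a) atTop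
      (𝓝 (relLen m x * freq p u)) :=
  tendsto_div_imageLen_of_abs_sub_le hm
    (fun k => (abs_sub_comm _ _).trans_le (abs_iterate_induce_sub_le P k u x z))
    (tendsto_occ_letter hm P x u)

theorem exists_eq_mul_freq (hm : 1 ≤ m) (P : IsPosProb p) {ℓ : ℕ} (hℓ : 1 ≤ ℓ)
    {R : LegalWord m ℓ → ℝ} (hR : (inducedMatrix m p ℓ).mulVec R = inflation m • R) :
    ∃ c, ∀ u, R u = c * freq p (List.ofFn u.1) := by
  obtain ⟨d, hd, hdlim⟩ := exists_tendsto_imageLen hm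
  obtain ⟨n, rfl⟩ : ∃ n, ℓ = n + 1 := ⟨ℓ - 1, by omega⟩
  refine ⟨d * ∑ w, R w * relLen m (w.1 0), fun u => ?_⟩
  have hinduce : Tendsto (fun k =>
      ∑ w, R w * ((induce p)^[k] (prefixInd (List.ofFn u.1)) (List.ofFn w.1) /
        imageLen m k Letter.a)) atTop
      (𝓝 (∑ w, R w * (relLen m (w.1 0) * freq p (List.ofFn u.1)))) :=
    tendsto_finsetSum _ fun w _ => by
      simpa only [List.ofFn_succ (f := w.1)] using
        (tendsto_iterate_induce_prefixInd hm P (List.ofFn u.1) _ _).const_mul (R w)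
  have hpow : Tendsto (fun k => R u / (imageLen m k Letter.a / inflation m ^ k)) atTop
      (𝓝 (R u / d)) := tendsto_const_nhds.div hdlim hd.ne'
  have hloc : IsLocal (n + 1) (prefixInd (List.ofFn u.1)) := by
    simpa using isLocal_prefixInd (List.ofFn u.1)
  have heq := tendsto_nhds_unique hpow (hinduce.congr fun k => ?_)
  · rw [div_eq_iff hd.ne'] at heq
    simp only [heq, ← mul_assoc, ← Finset.sum_mul]
    ring
  · simp only [← mul_div_assoc, ← Finset.sum_div, sum_mul_iterate_induce P hℓ hR hloc,
      sum_mul_prefixInd]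
    field_simp

theorem IsRightPF.eq_freq (hm : 1 ≤ m) (P : IsPosProb p) {ℓ : ℕ} (hℓ : 1 ≤ ℓ)
    {R : LegalWord m ℓ → ℝ} (hR : IsRightPF (inducedMatrix m p ℓ) R) (w : LegalWord m ℓ) :
    R w = freq p (List.ofFn w.1) := by
  obtain ⟨hpos, hsum, r, hr, -⟩ := id hR
  have hr_eq : r = inflation m := le_antisymm
    ((le_abs_self r).trans (abs_le_of_pos_eigenvector (inducedMatrix_nonneg P ℓ)
      (freq_ofFn_pos hm P hℓ) (inducedMatrix_mulVec_freq hm P hℓ) hR.ne_zero hr))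
    ((le_abs_self _).trans (abs_le_of_pos_eigenvector (inducedMatrix_nonneg P ℓ) hpos hr
      (isRightPF_freq hm P hℓ).ne_zero (inducedMatrix_mulVec_freq hm P hℓ)))
  obtain ⟨c, hc⟩ := exists_eq_mul_freq hm P hℓ (hr_eq ▸ hr)
  have hc_one : c = 1 := by
    simpa only [hc, ← Finset.mul_sum, sum_freq hm P, mul_one] using hsum
  rw [hc, hc_one, one_mul]

end Eigenvector

section QuasiAdditive

variable {α : Type*}

/-- Quasi-additivity of a function of words, with defect `C`. It is what remains of additivity for a
count of occurrences, since occurrences may straddle the place where two words are joined. -/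
def IsQuasiAdditive (C : ℝ) (F : List α → ℝ) : Prop :=
  ∀ s t, |F (s ++ t) - (F s + F t)| ≤ C

theorem IsQuasiAdditive.abs_append_sub_le {C : ℝ} {F : List α → ℝ} (hF : IsQuasiAdditive C F)
    (hlen : ∀ v, |F v| ≤ v.length) (s v t : List α) :
    |F (s ++ (v ++ t)) - F v| ≤ s.length + t.length + 2 * C := by
  have h₁ := abs_le.1 (hF s (v ++ t))
  have h₂ := abs_le.1 (hF v t)
  have h₃ := abs_le.1 (hlen s)
  have h₄ := abs_le.1 (hlen t)
  rw [abs_le]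
  constructor <;> linarith

/-- The square of `F` on the window of length `W` at the beginning of a word; words shorter than the
window get the value `0`. -/
def windowSq (F : List α → ℝ) (W : ℕ) (t : List α) : ℝ :=
  if W ≤ t.length then F (t.take W) ^ 2 else 0

theorem windowSq_nonneg (F : List α → ℝ) (W : ℕ) (t : List α) : 0 ≤ windowSq F W t := by
  unfold windowSq
  split_ifs <;> positivity

theorem isLocal_windowSq (F : List α → ℝ) (W : ℕ) : IsLocal W (windowSq F W) := by
  intro s t hs
  have hst : W ≤ (s ++ t).length := by rw [List.length_append]; omega
  rw [windowSq, windowSq, if_pos hs, if_pos hst, List.take_append_of_le_length hs]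

theorem windowSq_of_length_eq (F : List α → ℝ) {W : ℕ} {t : List α} (h : t.length = W) :
    windowSq F W t = F t ^ 2 := by
  rw [windowSq, if_pos h.ge, List.take_of_length_le h.le]

theorem abs_windowSq_le {F : List α → ℝ} (hlen : ∀ v, |F v| ≤ v.length) (W : ℕ) (t : List α) :
    |windowSq F W t| ≤ (W : ℝ) ^ 2 := by
  rw [abs_of_nonneg (windowSq_nonneg F W t), windowSq]
  split_ifs with h
  · have h' := hlen (t.take W)
    rw [List.length_take, min_eq_left h] at h'
    exact sq_le_sq' (abs_le.1 h').1 (abs_le.1 h').2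
  · positivity

theorem take_append_append {s v t : List α} {W : ℕ} (h : s.length + v.length ≤ W) :
    (s ++ (v ++ t)).take W = s ++ (v ++ t.take (W - s.length - v.length)) := by
  rw [List.take_append, List.take_append, List.take_of_length_le (by omega),
    List.take_of_length_le (l := v) (by omega)]

theorem sq_le_three_mul {a b x d e : ℝ} (hd : |a - b| ≤ d) (he : |b - x| ≤ e) :
    a ^ 2 ≤ 3 * x ^ 2 + 3 * e ^ 2 + 3 * d ^ 2 := by
  have h₁ := sq_le_sq' (abs_le.1 hd).1 (abs_le.1 hd).2
  have h₂ := sq_le_sq' (abs_le.1 he).1 (abs_le.1 he).2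
  linarith [sq_nonneg (x - (b - x)), sq_nonneg (x - (a - b)), sq_nonneg (b - x - (a - b))]

theorem windowSq_append_le {F : List α → ℝ} {C : ℝ} (hF : IsQuasiAdditive C F)
    (hlen : ∀ v, |F v| ≤ v.length) {s v t : List α} {W H : ℕ} (hs : s.length ≤ H)
    (hv : v.length + H ≤ W) (ht : t = [] ∨ W < v.length + 2 * H) {x e : ℝ} (hx : |F v - x| ≤ e) :
    windowSq F W (s ++ (v ++ t)) ≤ 3 * x ^ 2 + 3 * e ^ 2 + 3 * (3 * H + 2 * C) ^ 2 := by
  rw [windowSq]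
  split_ifs
  swap
  · positivity
  rw [take_append_append (by omega)]
  refine sq_le_three_mul ((hF.abs_append_sub_le hlen _ _ _).trans ?_) hx
  have hs' : (s.length : ℝ) ≤ H := by exact_mod_cast hs
  have ht' : ((t.take (W - s.length - v.length)).length : ℝ) ≤ 2 * H := by
    rcases ht with rfl | ht
    · simp
    · rw [List.length_take]
      exact_mod_cast (min_le_left _ _).trans (by omega)
  linarith

variable [DecidableEq α]

/-- The deviation of the number of occurrences of `u` from the value expected for density `c`. -/
def occDev (u : List α) (c : ℝ) (v : List α) : ℝ := occ u v - c * v.length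

theorem isQuasiAdditive_occDev (u : List α) (c : ℝ) : IsQuasiAdditive u.length (occDev u c) := by
  intro s t
  have h₁ := occ_add_le u s t
  have h₂ := occ_append_le u s t
  simp only [occDev, List.length_append, Nat.cast_add]
  rw [abs_le]
  constructor <;> linarith

theorem abs_occDev_le (u : List α) {c : ℝ} (hc₀ : 0 ≤ c) (hc₁ : c ≤ 1) (v : List α) :
    |occDev u c v| ≤ v.length := by
  have h₁ := occ_nonneg u v
  have h₂ := occ_le_length u v
  have h₃ : c * v.length ≤ v.length := mul_le_of_le_one_left (Nat.cast_nonneg _) hc₁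
  have h₄ : 0 ≤ c * v.length := by positivity
  rw [occDev, abs_le]
  constructor <;> linarith

end QuasiAdditive

section BlockSum

variable {m k : ℕ} {p : Fin (m + 1) → ℝ} {F : List Letter → ℝ}

/-- The sum of `F` over the blocks of a realisation of `ζ_m^k(y)` that come from the letters of `y`;
the blocks can be told apart since their lengths are deterministic. -/
def blockSum (m k : ℕ) (F : List Letter → ℝ) : List Letter → List Letter → ℝ
  | [], _ => 0
  | x :: y, v => F (v.take (imageLen m k x)) + blockSum m k F y (v.drop (imageLen m k x))

theorem blockSum_cons_append {x : Letter} {B : List Letter} (hB : IsIterImage m k [x] B)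
    (y v : List Letter) : blockSum m k F (x :: y) (B ++ v) = F B + blockSum m k F y v := by
  have hlen : B.length = imageLen m k x := by simpa using hB.length_eq
  rw [blockSum, List.take_left' hlen, List.drop_left' hlen]

theorem IsQuasiAdditive.abs_sub_blockSum_le {C : ℝ} (hF : IsQuasiAdditive C F) (hnil : F [] = 0)
    {y v : List Letter} (hv : IsIterImage m k y v) :
    |F v - blockSum m k F y v| ≤ C * y.length := by
  induction y generalizing v with
  | nil => simp [isIterImage_nil.1 hv, blockSum, hnil]
  | cons x y ih =>
    rw [← List.singleton_append, isIterImage_append] at hv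
    obtain ⟨B, v, hB, hv, rfl⟩ := hv
    have h₁ := abs_le.1 (ih hv)
    have h₂ := abs_le.1 (hF B v)
    rw [blockSum_cons_append hB, List.length_cons, Nat.cast_add, Nat.cast_one, abs_le]
    constructor <;> linarith

theorem iterate_expect_blockSum_cons (P : IsPosProb p) (G : ℝ → ℝ) (x : Letter)
    (y : List Letter) :
    (expect p)^[k] (fun v => G (blockSum m k F (x :: y) v)) (x :: y) =
      (expect p)^[k] (fun B => (expect p)^[k] (fun v => G (F B + blockSum m k F y v)) y) [x] := by
  rw [← List.singleton_append, iterate_expect_append]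
  exact iterate_expect_congr P fun B hB => iterate_expect_congr P fun v _ => by
    rw [List.singleton_append, blockSum_cons_append hB]

theorem iterate_expect_blockSum (P : IsPosProb p) (y : List Letter) :
    (expect p)^[k] (blockSum m k F y) y = (y.map fun x => (expect p)^[k] F [x]).sum := by
  induction y with
  | nil => exact iterate_expect_nil k _
  | cons x y ih =>
    refine (iterate_expect_blockSum_cons P (fun t => t) x y).trans ?_
    simp only [iterate_expect_add, iterate_expect_const P, ih, List.map_cons, List.sum_cons]

theorem abs_iterate_expect_blockSum_le (P : IsPosProb p) {ε : ℝ}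
    (h : ∀ x, |(expect p)^[k] F [x]| ≤ ε * imageLen m k x) (y : List Letter) :
    |(expect p)^[k] (blockSum m k F y) y| ≤ ε * wordLen m k y := by
  rw [iterate_expect_blockSum P]
  induction y with
  | nil => simp
  | cons x y ih =>
    rw [List.map_cons, List.sum_cons, wordLen_cons, Nat.cast_add, mul_add]
    exact (abs_add_le _ _).trans (add_le_add (h x) ih)

theorem iterate_expect_add_sq (P : IsPosProb p) (c : ℝ) (X : List Letter → ℝ) (y : List Letter) :
    (expect p)^[k] (fun v => (c + X v) ^ 2) y =
      c ^ 2 + 2 * (expect p)^[k] X y * c + (expect p)^[k] (fun v => X v ^ 2) y := by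
  have hsq : (fun v => (c + X v) ^ 2) = fun v => (c ^ 2 + 2 * c * X v) + X v ^ 2 := by
    funext v
    ring
  rw [hsq, iterate_expect_add, iterate_expect_add, iterate_expect_const P,
    iterate_expect_const_mul]
  ring

-- The blocks are independent, so the variance of their sum is the sum of their variances.
theorem iterate_expect_blockSum_sq_le (P : IsPosProb p) {b : ℝ}
    (hb : ∀ x v, IsIterImage m k [x] v → F v ^ 2 ≤ b) (y : List Letter) :
    (expect p)^[k] (fun v => blockSum m k F y v ^ 2) y ≤
      y.length * b + ((expect p)^[k] (blockSum m k F y) y) ^ 2 := by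
  induction y with
  | nil => simp [iterate_expect_nil, blockSum]
  | cons x y ih =>
    have hblock : (expect p)^[k] (fun B => F B ^ 2) [x] ≤ b := iterate_expect_le_const P (hb x)
    rw [iterate_expect_blockSum_cons P (fun t => t ^ 2), iterate_expect_blockSum P,
      List.map_cons, List.sum_cons, ← iterate_expect_blockSum P]
    simp only [iterate_expect_add_sq P, iterate_expect_add, iterate_expect_const P,
      iterate_expect_const_mul, List.length_cons, Nat.cast_add, Nat.cast_one]
    nlinarith [sq_nonneg ((expect p)^[k] F [x])]

theorem exists_append_wordLen_le (hm : 1 ≤ m) (k N : ℕ) (z : List Letter) :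
    ∃ y y', z = y ++ y' ∧ wordLen m k y ≤ N ∧
      (y' = [] ∨ N < wordLen m k y + imageLen m k Letter.a) := by
  induction z generalizing N with
  | nil => exact ⟨[], [], rfl, by simp, Or.inl rfl⟩
  | cons x z ih =>
    by_cases h : imageLen m k x ≤ N
    · obtain ⟨y, y', rfl, h₁, h₂⟩ := ih (N - imageLen m k x)
      refine ⟨x :: y, y', rfl, ?_, h₂.imp_right fun h₂ => ?_⟩ <;> rw [wordLen_cons] <;> omega
    · have := imageLen_le_a hm k x
      exact ⟨[], x :: z, rfl, by simp, Or.inr (by rw [wordLen_nil]; omega)⟩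

theorem length_mul_le_wordLen (hm : 1 ≤ m) (k : ℕ) (y : List Letter) :
    y.length * k ≤ wordLen m k y := by
  induction y with
  | nil => simp
  | cons x y ih =>
    have := le_imageLen hm k x
    rw [List.length_cons, wordLen_cons, Nat.succ_mul]
    omega

/-- The bound on the mean of `windowSq F W` that comes from a decomposition of the window into
blocks of length at most `H`, when the mean of `F` on each block is at most `ε` per letter. -/
def windowBound (H W : ℕ) (C ε : ℝ) : ℝ :=
  3 * W * (H : ℝ) ^ 2 + 6 * (ε * W) ^ 2 + 3 * (3 * H + 2 * C) ^ 2

theorem iterate_expect_blockSum_sq_le_windowBound (hm : 1 ≤ m) (P : IsPosProb p) {C ε : ℝ}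
    (hC : 0 ≤ C) (hlen : ∀ v, |F v| ≤ v.length) (hε : 0 ≤ ε) (hCk : C ≤ ε * k)
    (h : ∀ x, |(expect p)^[k] F [x]| ≤ ε * imageLen m k x) {W : ℕ} {y : List Letter}
    (hy : wordLen m k y ≤ W) :
    3 * (expect p)^[k] (fun v => blockSum m k F y v ^ 2) y + 3 * (C * y.length) ^ 2 +
      3 * (3 * imageLen m k Letter.a + 2 * C) ^ 2 ≤ windowBound (imageLen m k Letter.a) W C ε := by
  have hyW : (wordLen m k y : ℝ) ≤ W := by exact_mod_cast hy
  have hvar : (expect p)^[k] (fun v => blockSum m k F y v ^ 2) y ≤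
      W * (imageLen m k Letter.a : ℝ) ^ 2 + (ε * W) ^ 2 := by
    refine (iterate_expect_blockSum_sq_le P (b := (imageLen m k Letter.a : ℝ) ^ 2)
      (fun x v hv => ?_) y).trans (add_le_add ?_ ?_)
    · have hv' : (v.length : ℝ) ≤ imageLen m k Letter.a := by
        rw [hv.length_eq]
        exact_mod_cast (by simpa using imageLen_le_a hm k x)
      exact sq_le_sq' (by linarith [abs_le.1 (hlen v)]) (by linarith [abs_le.1 (hlen v)])
    · gcongr
      exact_mod_cast (length_le_wordLen k y).trans hy
    · have hmean := (abs_iterate_expect_blockSum_le P h y).trans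
        (mul_le_mul_of_nonneg_left hyW hε)
      exact sq_le_sq' (abs_le.1 hmean).1 (abs_le.1 hmean).2
  have hdefect : C * y.length ≤ ε * W :=
    calc C * y.length ≤ ε * k * y.length := by gcongr
      _ = ε * (y.length * k : ℕ) := by push_cast; ring
      _ ≤ ε * W := by gcongr; exact (length_mul_le_wordLen hm k y).trans hy
  have hdefect_sq : (C * y.length) ^ 2 ≤ (ε * W) ^ 2 := by gcongr
  rw [windowBound]
  linarith

theorem iterate_induce_windowSq_le (hm : 1 ≤ m) (P : IsPosProb p) {C ε : ℝ}
    (hF : IsQuasiAdditive C F) (hlen : ∀ v, |F v| ≤ v.length) (hε : 0 ≤ ε) (hCk : C ≤ ε * k)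
    (h : ∀ x, |(expect p)^[k] F [x]| ≤ ε * imageLen m k x) {W : ℕ}
    (hW : imageLen m k Letter.a ≤ W) (x : Letter) (z : List Letter) :
    (induce p)^[k] (windowSq F W) (x :: z) ≤
      imageLen m k x * windowBound (imageLen m k Letter.a) W C ε := by
  obtain ⟨y, y', rfl, hy, hy'⟩ := exists_append_wordLen_le hm k (W - imageLen m k Letter.a) z
  have hC : 0 ≤ C := (abs_nonneg _).trans (hF [] [])
  have hnil : F [] = 0 := abs_nonpos_iff.1 (by simpa using hlen [])
  rw [iterate_induce_cons_eq_expect P]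
  refine iterate_expect_le_const P fun B hB => ?_
  have hBlen : B.length = imageLen m k x := by simpa using hB.length_eq
  rw [iterate_expect_append]
  calc _ ≤ (expect p)^[k] (fun v => imageLen m k x *
        (3 * blockSum m k F y v ^ 2 + 3 * (C * y.length) ^ 2 +
          3 * (3 * imageLen m k Letter.a + 2 * C) ^ 2)) y := by
        refine iterate_expect_mono P fun v hv => iterate_expect_le_const P fun v' hv' => ?_
        rw [← hBlen, ← tailSum_const]
        refine tailSum_mono fun t _ ht => ?_
        have hvlen := hv.length_eq
        refine windowSq_append_le hF hlen
          (ht.length_le.trans (hBlen.trans_le (imageLen_le_a hm k x))) (by omega) ?_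
          (hF.abs_sub_blockSum_le hnil hv)
        exact hy'.imp (fun hnil' => by rwa [hnil', isIterImage_nil] at hv') fun hlt => by omega
    _ = imageLen m k x * (3 * (expect p)^[k] (fun v => blockSum m k F y v ^ 2) y +
        3 * (C * y.length) ^ 2 + 3 * (3 * imageLen m k Letter.a + 2 * C) ^ 2) := by
        simp only [iterate_expect_const_mul, iterate_expect_add, iterate_expect_const P]
    _ ≤ _ := by
        gcongr
        exact iterate_expect_blockSum_sq_le_windowBound hm P hC hlen hε hCk h
          (hy.trans (Nat.sub_le _ _))

end BlockSum

section SecondMoment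

variable {m : ℕ} {p : Fin (m + 1) → ℝ}

theorem freq_nonneg (hm : 1 ≤ m) (P : IsPosProb p) (u : List Letter) : 0 ≤ freq p u :=
  ge_of_tendsto' (tendsto_freq hm P u) fun _ =>
    div_nonneg (iterate_expect_nonneg P (occ_nonneg u)) (Nat.cast_nonneg _)

theorem freq_le_one (hm : 1 ≤ m) (P : IsPosProb p) (u : List Letter) : freq p u ≤ 1 := by
  refine le_of_tendsto' (tendsto_freq hm P u) fun k => div_le_one_of_le₀ ?_ (Nat.cast_nonneg _)
  refine iterate_expect_le_const P fun v hv => (occ_le_length u v).trans_eq ?_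
  rw [hv.length_eq, wordLen_singleton]

theorem iterate_expect_occDev (P : IsPosProb p) (k : ℕ) (u : List Letter) (c : ℝ) (x : Letter) :
    (expect p)^[k] (occDev u c) [x] = (expect p)^[k] (occ u) [x] - c * imageLen m k x := by
  have hlen : (expect p)^[k] (fun v => c * v.length) [x] = c * imageLen m k x :=
    iterate_expect_eq_const P fun v hv => by rw [hv.length_eq, wordLen_singleton]
  rw [← hlen, ← iterate_expect_sub]
  rfl

theorem eventually_abs_iterate_expect_occDev_le (hm : 1 ≤ m) (P : IsPosProb p) (u : List Letter)
    {ε : ℝ} (hε : 0 < ε) : ∀ᶠ k in atTop, ∀ x : Letter,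
      |(expect p)^[k] (occDev u (freq p u)) [x]| ≤ ε * imageLen m k x := by
  simp only [iterate_expect_occDev P]
  have h : ∀ᶠ k in atTop, |(expect p)^[k] (occ u) [Letter.a] -
      freq p u * imageLen m k Letter.a| ≤ ε * imageLen m k Letter.a := by
    filter_upwards [Metric.tendsto_nhds.1 (tendsto_freq hm P u) ε hε] with k hk
    have hp : (0 : ℝ) < imageLen m k Letter.a := by exact_mod_cast imageLen_pos k _
    rw [Real.dist_eq, div_sub' hp.ne', abs_div, abs_of_pos hp, div_lt_iff₀ hp] at hk
    rw [mul_comm (freq p u)]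
    exact hk.le
  obtain ⟨n, hn⟩ := eventually_atTop.1 h
  refine eventually_atTop.2 ⟨n + 1, fun k hk x => ?_⟩
  obtain ⟨k, rfl⟩ : ∃ j, k = j + 1 := ⟨k - 1, by omega⟩
  cases x with
  | a => exact hn _ (by omega)
  | b =>
    rw [iterate_expect_succ_b P]
    exact hn k (by omega)

theorem sum_sq_mul_freq_le (hm : 1 ≤ m) (P : IsPosProb p) {F : List Letter → ℝ}
    (hlen : ∀ v, |F v| ≤ v.length) {k W : ℕ} {K : ℝ}
    (h : ∀ x z, (induce p)^[k] (windowSq F W) (x :: z) ≤ imageLen m k x * K) :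
    ∑ w : LegalWord m W, F (List.ofFn w.1) ^ 2 * freq p (List.ofFn w.1) ≤ K := by
  have hlim := tendsto_tailSum hm P (isLocal_windowSq F W) (abs_windowSq_le hlen W)
  simp only [windowSq_of_length_eq F (List.length_ofFn (f := Subtype.val _))] at hlim
  have hsum : ∀ y, tailSum ((induce p)^[k] (windowSq F W)) y ≤ wordLen m k y * K := by
    intro y
    induction y with
    | nil => simp [tailSum]
    | cons x y ih =>
      rw [tailSum, wordLen_cons, Nat.cast_add, add_mul]
      exact add_le_add (h x y) ih
  refine le_of_tendsto ((tendsto_add_atTop_iff_nat k).2 hlim) (Eventually.of_forall fun n => ?_)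
  have hp : (0 : ℝ) < imageLen m (n + k) Letter.a := by exact_mod_cast imageLen_pos _ _
  rw [div_le_iff₀ hp, Function.iterate_add_apply, iterate_expect_tailSum P]
  refine iterate_expect_le_const P fun v hv => (hsum v).trans_eq ?_
  rw [hv.wordLen_eq, wordLen_singleton, mul_comm]

theorem eventually_windowBound_le (H : ℕ) (C : ℝ) {δ ε : ℝ} (hδ : 6 * δ ^ 2 < ε) :
    ∀ᶠ W : ℕ in atTop, windowBound H W C δ ≤ ε * (W : ℝ) ^ 2 := by
  have hinv : Tendsto (fun W : ℕ => (W : ℝ)⁻¹) atTop (𝓝 0) := tendsto_inv_atTop_nhds_zero_nat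
  have hlim : Tendsto (fun W : ℕ => 3 * (H : ℝ) ^ 2 * (W : ℝ)⁻¹ + 6 * δ ^ 2 +
      3 * (3 * H + 2 * C) ^ 2 * ((W : ℝ)⁻¹) ^ 2) atTop (𝓝 (6 * δ ^ 2)) := by
    simpa using ((hinv.const_mul (3 * (H : ℝ) ^ 2)).add_const (6 * δ ^ 2)).add
      ((hinv.pow 2).const_mul (3 * (3 * H + 2 * C) ^ 2))
  filter_upwards [hlim.eventually_le_const hδ, eventually_gt_atTop 0] with W hW hpos
  have : (0 : ℝ) < W := by exact_mod_cast hpos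
  calc windowBound H W C δ = (3 * (H : ℝ) ^ 2 * (W : ℝ)⁻¹ + 6 * δ ^ 2 +
        3 * (3 * H + 2 * C) ^ 2 * ((W : ℝ)⁻¹) ^ 2) * (W : ℝ) ^ 2 := by
        rw [windowBound]
        field_simp
    _ ≤ ε * (W : ℝ) ^ 2 := by gcongr

theorem eventually_sum_occDev_sq_le (hm : 1 ≤ m) (P : IsPosProb p) (u : List Letter) {ε : ℝ}
    (hε : 0 < ε) : ∀ᶠ W in atTop, ∑ w : LegalWord m W,
      occDev u (freq p u) (List.ofFn w.1) ^ 2 * freq p (List.ofFn w.1) ≤ ε * (W : ℝ) ^ 2 := by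
  obtain ⟨δ, hδ, hδε⟩ : ∃ δ : ℝ, 0 < δ ∧ 6 * δ ^ 2 < ε := by
    refine ⟨√(ε / 12), by positivity, ?_⟩
    rw [Real.sq_sqrt (by positivity)]
    linarith
  obtain ⟨k, h, huk⟩ := ((eventually_abs_iterate_expect_occDev_le hm P u hδ).and
    ((tendsto_natCast_atTop_atTop.const_mul_atTop hδ).eventually_ge_atTop (u.length : ℝ))).exists
  filter_upwards [eventually_windowBound_le (imageLen m k Letter.a) u.length hδε,
    eventually_ge_atTop (imageLen m k Letter.a)] with W hbound hW
  have hlen := abs_occDev_le u (freq_nonneg hm P u) (freq_le_one hm P u)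
  exact (sum_sq_mul_freq_le hm P hlen (iterate_induce_windowSq_le hm P
    (isQuasiAdditive_occDev u _) hlen hδ.le huk h hW)).trans hbound

end SecondMoment

/-! ### Factors of elements of the hull -/

section Hull

variable {m : ℕ}

/-- The factor `x_{[k, k + n - 1]}` of a two-sided sequence. -/
def factor (x : ℤ → Letter) (k : ℤ) (n : ℕ) : List Letter :=
  List.ofFn fun j : Fin n => x (k + (j : ℕ))

@[simp] theorem length_factor (x : ℤ → Letter) (k : ℤ) (n : ℕ) : (factor x k n).length = n :=
  List.length_ofFn

theorem getElem?_factor {x : ℤ → Letter} {k : ℤ} {n j : ℕ} (hj : j < n) :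
    (factor x k n)[j]? = some (x (k + j)) := by
  simp [factor, hj]

theorem factor_eq_iff {x : ℤ → Letter} {k : ℤ} {n : ℕ} {v : List Letter} (hv : v.length = n) :
    factor x k n = v ↔ ∀ j < n, v[j]? = some (x (k + j)) := by
  refine ⟨fun h _ hj => h ▸ getElem?_factor hj, fun h => List.ext_getElem? fun j => ?_⟩
  by_cases hj : j < n
  · rw [getElem?_factor hj, h j hj]
  · rw [List.getElem?_eq_none (by simpa using hj), List.getElem?_eq_none (by omega)]

theorem factor_shift (x : ℤ → Letter) (k : ℤ) (n : ℕ) :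
    factor (shift x) k n = factor x (k + 1) n :=
  congrArg List.ofFn (funext fun _ => congrArg x (add_right_comm k _ 1))

theorem take_factor (x : ℤ → Letter) (k : ℤ) {l n : ℕ} (h : l ≤ n) :
    (factor x k n).take l = factor x k l := by
  refine ((factor_eq_iff (by simpa)).2 fun j hj => ?_).symm
  rw [List.getElem?_take_of_lt hj, getElem?_factor (hj.trans_le h)]

theorem drop_factor (x : ℤ → Letter) (k : ℤ) (i n : ℕ) :
    (factor x k n).drop i = factor x (k + i) (n - i) := by
  refine ((factor_eq_iff (by simp)).2 fun j hj => ?_).symm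
  rw [List.getElem?_drop, getElem?_factor (by omega), Nat.cast_add, add_assoc]

theorem AgreesOn.le_length {n : ℕ} {x : ℤ → Letter} {u v : List Letter}
    (h : AgreesOn n x u v) : n ≤ u.length ∧ n ≤ v.length := by
  rcases n.eq_zero_or_pos with rfl | hn
  · exact ⟨Nat.zero_le _, Nat.zero_le _⟩
  · obtain ⟨hv, hu⟩ := h (n - 1) (by omega)
    obtain ⟨hv, -⟩ := List.getElem?_eq_some_iff.1 hv
    obtain ⟨hu, -⟩ := List.getElem?_eq_some_iff.1 hu
    rw [List.length_reverse] at hu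
    omega

theorem AgreesOn.getElem?_append {n : ℕ} {x : ℤ → Letter} {u v : List Letter}
    (h : AgreesOn n x u v) {i : ℤ} (h₁ : -(n : ℤ) ≤ i) (h₂ : i < n) :
    (u ++ v)[(u.length + i).toNat]? = some (x i) := by
  have hn := h.le_length.1
  rcases le_or_gt 0 i with hi | hi
  · obtain ⟨j, rfl⟩ := Int.eq_ofNat_of_zero_le hi
    rw [List.getElem?_append_right (by omega), ← (h j (by omega)).1]
    congr 1
    omega
  · obtain ⟨j, rfl⟩ : ∃ j : ℕ, i = -(j + 1) := ⟨(-i - 1).toNat, by omega⟩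
    rw [List.getElem?_append_left (by omega), ← (h j (by omega)).2,
      List.getElem?_reverse (by omega)]
    congr 1
    omega

theorem AgreesOn.factor_isInfix {n : ℕ} {x : ℤ → Letter} {u v : List Letter}
    (h : AgreesOn n x u v) {k : ℤ} {l : ℕ} (h₁ : -(n : ℤ) ≤ k) (h₂ : k + l ≤ n) :
    factor x k l <:+: u ++ v := by
  have hn := h.le_length
  have hfactor : factor x k l = ((u ++ v).drop (u.length + k).toNat).take l := by
    refine (factor_eq_iff ?_).2 fun j hj => ?_
    · rw [List.length_take, List.length_drop, List.length_append]
      omega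
    · rw [List.getElem?_take_of_lt hj, List.getElem?_drop,
        ← h.getElem?_append (i := k + j) (by omega) (by omega)]
      congr 1
      omega
  rw [hfactor]
  exact (List.take_prefix _ _).isInfix.trans (List.drop_suffix _ _).isInfix

theorem isLegal_factor_of_mem_accPoints (hm : 1 ≤ m) {x : ℤ → Letter} (hx : x ∈ accPoints m)
    (k : ℤ) (n : ℕ) : IsLegal m (factor x k n) := by
  obtain ⟨i, -, u, v, hu, hv, h⟩ := hx (k.natAbs + n) 0
  have huv : IsLegal m (u ++ v) := (isLegal_aa hm).isIterImage
    (isIterImage_append (w₁ := [Letter.a]).2 ⟨u, v, hu, hv, rfl⟩)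
  exact huv.infix (h.factor_isInfix (by omega) (by omega))

theorem isLegal_factor (hm : 1 ≤ m) {x : ℤ → Letter} (hx : x ∈ hull m) (k : ℤ) (n : ℕ) :
    IsLegal m (factor x k n) := by
  suffices h : hull m ⊆ {x | ∀ k n, IsLegal m (factor x k n)} from h hx k n
  refine Set.sInter_subset_of_mem ⟨?_, ?_, fun x hx => isLegal_factor_of_mem_accPoints hm hx⟩
  · simp only [Set.ofPred_forall]
    refine isClosed_iInter fun k => isClosed_iInter fun n => ?_
    have hc : Continuous fun (x : ℤ → Letter) (j : Fin n) => x (k + (j : ℕ)) := by fun_prop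
    exact (isClosed_discrete {w : Fin n → Letter | IsLegal m (List.ofFn w)}).preimage hc
  · ext x
    simp only [Set.mem_preimage, Set.mem_ofPred_eq, factor_shift]
    exact (Equiv.addRight (1 : ℤ)).forall_congr_right (q := fun k => ∀ n, IsLegal m (factor x k n))

theorem accPoints_subset_hull : accPoints m ⊆ hull m :=
  Set.subset_sInter fun _ hY => hY.2.2

theorem isClosed_hull : IsClosed (hull m) := isClosed_sInter fun _ hY => hY.1

instance : CompactSpace (hull m) := isCompact_iff_compactSpace.1 isClosed_hull.isCompact

theorem eventually_eq_on_finset (s : Finset ℤ) (x : ℤ → Letter) :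
    ∀ᶠ y in 𝓝 x, ∀ i ∈ s, y i = x i := by
  rw [Filter.eventually_all_finset]
  intro i _
  exact (continuous_apply i).continuousAt.eventually
    ((isOpen_discrete {x i}).mem_nhds (Set.mem_singleton _))

theorem factor_iterate_shift (x : ℤ → Letter) (i : ℕ) (k : ℤ) (n : ℕ) :
    factor (shift^[i] x) k n = factor x (k + i) n := by
  induction i generalizing k with
  | zero => simp
  | succ i ih =>
    rw [Function.iterate_succ_apply', factor_shift, ih]
    congr 1
    push_cast
    ring

theorem iterate_shift_mem_hull {x : ℤ → Letter} (hx : x ∈ hull m) (n : ℕ) :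
    shift^[n] x ∈ hull m := by
  induction n with
  | zero => exact hx
  | succ n ih => rwa [Function.iterate_succ_apply', shift_mem_hull]

/-- The two-sided sequence that continues the marked word `u|v` by the letter `a`. -/
def extend (u v : List Letter) (i : ℤ) : Letter :=
  if 0 ≤ i then v.getD i.toNat Letter.a else u.reverse.getD (-i - 1).toNat Letter.a

theorem agreesOn_extend {n : ℕ} {u v : List Letter} (hu : n ≤ u.length) (hv : n ≤ v.length) :
    AgreesOn n (extend u v) u v := by
  intro j hj
  have hneg : (-(-((j : ℤ) + 1)) - 1).toNat = j := by omega
  rw [extend, extend, if_pos (by omega), if_neg (by omega), hneg, Int.toNat_natCast]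
  simp [List.getD_eq_getElem?_getD, hj.trans_le hv, hj.trans_le hu]

/-- `v` begins realisations of `ζ_m^n(a)` with `n` arbitrarily large, and compactness provides an
accumulation point of these. -/
theorem IsIterImage.exists_mem_accPoints (hm : 1 ≤ m) {k : ℕ} {v : List Letter}
    (hv : IsIterImage m k [Letter.a] v) : ∃ x ∈ accPoints m, factor x 0 v.length = v := by
  choose V hV hvV using hv.exists_prefix hm
  have hlen : ∀ n, n ≤ (V n).length := fun n => by
    have := lt_imageLen_a hm (n + k)
    rw [(hV n).length_eq, wordLen_singleton]
    omega
  obtain ⟨x, hx⟩ := exists_clusterPt_of_compactSpace (map (fun n => extend (V n) (V n)) atTop)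
  have happrox : ∀ N K : ℕ, ∃ n, K ≤ n ∧ AgreesOn N x (V n) (V n) := by
    intro N K
    obtain ⟨n, hn, h⟩ := (frequently_atTop.1 (mapClusterPt_iff_frequently.1 hx _
      (eventually_eq_on_finset (Finset.Ico (-(N : ℤ)) N) x))) (max K N)
    have hN : N ≤ (V n).length := (le_of_max_le_right hn).trans (hlen n)
    refine ⟨n, le_of_max_le_left hn, fun j hj => ?_⟩
    rw [← h _ (Finset.mem_Ico.2 ⟨by omega, by omega⟩),
      ← h _ (Finset.mem_Ico.2 ⟨by omega, by omega⟩)]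
    exact agreesOn_extend hN hN j hj
  refine ⟨x, fun N K => ?_, (factor_eq_iff rfl).2 fun j hj => ?_⟩
  · obtain ⟨n, hK, h⟩ := happrox N K
    exact ⟨n + k, by omega, V n, V n, hV n, hV n, h⟩
  · obtain ⟨n, -, h⟩ := happrox v.length 0
    obtain ⟨t, ht⟩ := hvV n
    rw [zero_add, ← (h j hj).1, ← ht, List.getElem?_append_left hj]

theorem IsLegal.exists_mem_hull (hm : 1 ≤ m) {v : List Letter} (hv : IsLegal m v) :
    ∃ x ∈ hull m, factor x 0 v.length = v := by
  obtain ⟨k, hk, _, hw, s, t, rfl⟩ := hv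
  obtain ⟨k, rfl⟩ : ∃ j, k = j + 1 := ⟨k - 1, by omega⟩
  obtain ⟨x, hx, h⟩ := (isIterImage_succ_b.1 hw).exists_mem_accPoints hm
  refine ⟨_, iterate_shift_mem_hull (accPoints_subset_hull hx) s.length, ?_⟩
  have hdrop := congrArg (fun w => (w.drop s.length).take v.length) h
  simp only [List.append_assoc, drop_factor, List.drop_left, List.take_left] at hdrop
  rw [take_factor _ _ (by simp)] at hdrop
  rwa [factor_iterate_shift]

end Hull

/-! ### The pointwise ergodic theorem for ergodic transformations -/

section Birkhoff

variable {α : Type*} {T : α → α} {f : α → ℝ}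

/-- The maximum of `0` and the first `n` Birkhoff sums, written as a recursion. -/
def maxBirkhoff (T : α → α) (f : α → ℝ) : ℕ → α → ℝ
  | 0, _ => 0
  | n + 1, x => max 0 (f x + maxBirkhoff T f n (T x))

theorem maxBirkhoff_succ (n : ℕ) (x : α) :
    maxBirkhoff T f (n + 1) x = max 0 (f x + maxBirkhoff T f n (T x)) := rfl

theorem maxBirkhoff_nonneg (n : ℕ) (x : α) : 0 ≤ maxBirkhoff T f n x := by
  cases n with
  | zero => exact le_rfl
  | succ n => exact le_max_left _ _

theorem monotone_maxBirkhoff (x : α) : Monotone fun n => maxBirkhoff T f n x := by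
  refine monotone_nat_of_le_succ fun n => ?_
  induction n generalizing x with
  | zero => exact maxBirkhoff_nonneg 1 x
  | succ n ih => exact max_le_max le_rfl (add_le_add_right (ih (T x)) _)

theorem birkhoffSum_le_maxBirkhoff (n : ℕ) (x : α) :
    birkhoffSum T f n x ≤ maxBirkhoff T f n x := by
  induction n generalizing x with
  | zero => simp [maxBirkhoff]
  | succ n ih =>
    rw [birkhoffSum_succ']
    exact (add_le_add_right (ih (T x)) _).trans (le_max_right _ _)

theorem abs_maxBirkhoff_succ_sub_le (n : ℕ) (x : α) :
    |maxBirkhoff T f (n + 1) x - maxBirkhoff T f n (T x)| ≤ |f x| := by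
  have hnonneg : 0 ≤ maxBirkhoff T f n (T x) := maxBirkhoff_nonneg n (T x)
  rw [maxBirkhoff_succ, abs_le]
  constructor
  · linarith [le_max_right 0 (f x + maxBirkhoff T f n (T x)), neg_abs_le (f x)]
  · rw [sub_le_iff_le_add]
    exact max_le (by positivity) (by linarith [le_abs_self (f x)])

theorem bddAbove_maxBirkhoff_apply_iff (x : α) :
    BddAbove (Set.range fun n => maxBirkhoff T f n (T x)) ↔
      BddAbove (Set.range fun n => maxBirkhoff T f n x) := by
  constructor
  · rintro ⟨K, hK⟩
    refine ⟨max 0 (f x + K), Set.forall_mem_range.2 fun n => ?_⟩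
    exact (monotone_maxBirkhoff x n.le_succ).trans
      (max_le_max le_rfl (add_le_add_right (hK ⟨n, rfl⟩) _))
  · rintro ⟨K, hK⟩
    refine ⟨K - f x, Set.forall_mem_range.2 fun n => le_sub_iff_add_le'.2 ?_⟩
    exact (le_max_right _ _).trans (hK ⟨n + 1, rfl⟩)

theorem sum_Icc_zpow_apply_eq_birkhoffSum {M : Type*} [AddCommMonoid M] (T : Equiv.Perm α)
    (f : α → M) (s : ℤ) (N : ℕ) (x : α) :
    ∑ i ∈ Finset.Icc s (N + s - 1), f ((T ^ i) x) = birkhoffSum T f N ((T ^ s) x) := by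
  symm
  refine Finset.sum_bij (fun j _ => (j : ℤ) + s) ?_ ?_ ?_ ?_
  · intro j hj
    simp only [Finset.mem_range, Finset.mem_Icc] at hj ⊢
    omega
  · intro j _ j' _ h
    simpa using h
  · intro i hi
    simp only [Finset.mem_Icc] at hi
    exact ⟨(i - s).toNat, by simp; omega, by omega⟩
  · intro j _
    rw [zpow_add, zpow_natCast, Equiv.Perm.mul_apply, Equiv.Perm.coe_pow]

variable [MeasurableSpace α] {μ : Measure α}

theorem measurable_maxBirkhoff (hT : Measurable T) (hf : Measurable f) (n : ℕ) :
    Measurable (maxBirkhoff T f n) := by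
  induction n with
  | zero => exact measurable_const
  | succ n ih => exact measurable_const.max (hf.add (ih.comp hT))

theorem integrable_maxBirkhoff (hT : MeasurePreserving T μ μ) (hf : Integrable f μ) (n : ℕ) :
    Integrable (maxBirkhoff T f n) μ := by
  induction n with
  | zero => exact integrable_zero α ℝ μ
  | succ n ih =>
    exact (integrable_zero α ℝ μ).sup (hf.add (hT.integrable_comp_of_integrable ih))

theorem integral_maxBirkhoff_succ_sub_nonneg (hT : MeasurePreserving T μ μ) (hf : Integrable f μ)
    (n : ℕ) : 0 ≤ ∫ x, (maxBirkhoff T f (n + 1) x - maxBirkhoff T f n (T x)) ∂μ := by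
  have hInt := integrable_maxBirkhoff hT hf
  have hmap : ∫ x, maxBirkhoff T f n (T x) ∂μ = ∫ x, maxBirkhoff T f n x ∂μ := by
    conv_rhs => rw [← hT.map_eq]
    exact (integral_map hT.measurable.aemeasurable (hT.map_eq.symm ▸ (hInt n).1)).symm
  have hcomp : Integrable (fun x => maxBirkhoff T f n (T x)) μ :=
    hT.integrable_comp_of_integrable (hInt n)
  rw [integral_sub (hInt _) hcomp, hmap, sub_nonneg]
  exact integral_mono (hInt _) (hInt _) fun x => monotone_maxBirkhoff x n.le_succ

/-- Where the maxima tend to infinity, their increments along `T` are eventually equal to `f`. -/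
theorem integral_nonneg_of_tendsto_maxBirkhoff (hT : MeasurePreserving T μ μ)
    (hf : Integrable f μ) (h : ∀ᵐ x ∂μ, Tendsto (fun n => maxBirkhoff T f n (T x)) atTop atTop) :
    0 ≤ ∫ x, f x ∂μ := by
  have hInt := integrable_maxBirkhoff hT hf
  refine ge_of_tendsto' (tendsto_integral_of_dominated_convergence (fun x => |f x|)
    (fun n => ((hInt (n + 1)).sub (hT.integrable_comp_of_integrable (hInt n))).1) hf.abs
    (fun n => Eventually.of_forall fun x => abs_maxBirkhoff_succ_sub_le n x) ?_)
    (integral_maxBirkhoff_succ_sub_nonneg hT hf)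
  filter_upwards [h] with x hx
  refine tendsto_const_nhds.congr' ?_
  filter_upwards [hx.eventually_ge_atTop (-f x)] with n hn
  simp only [Pi.sub_apply, Function.comp_apply, maxBirkhoff_succ]
  rw [max_eq_right (by linarith), add_sub_cancel_right]

/-- The set where the Birkhoff sums are bounded above is invariant, hence null or conull, and it
is not null as `∫ f < 0`. -/
theorem ae_bddAbove_birkhoffSum (hT : Ergodic T μ) (hfm : Measurable f) (hf : Integrable f μ)
    (hneg : ∫ x, f x ∂μ < 0) :
    ∀ᵐ x ∂μ, BddAbove (Set.range fun n => birkhoffSum T f n x) := by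
  set B : Set α := {x | BddAbove (Set.range fun n => maxBirkhoff T f n x)}
  have hBm : MeasurableSet B :=
    measurableSet_bddAbove_range fun n => measurable_maxBirkhoff hT.measurable hfm n
  have hBT : T ⁻¹' B = B := Set.ext fun x => bddAbove_maxBirkhoff_apply_iff x
  rcases hT.toPreErgodic.ae_empty_or_univ hBm hBT with h | h
  · refine absurd (integral_nonneg_of_tendsto_maxBirkhoff hT.toMeasurePreserving hf ?_)
      (not_le.2 hneg)
    filter_upwards [h.mem_iff] with x hx
    refine tendsto_atTop_atTop_of_monotone' (monotone_maxBirkhoff (T x)) fun hbdd => ?_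
    exact hx.1 ((bddAbove_maxBirkhoff_apply_iff x).1 hbdd)
  · filter_upwards [h.mem_iff] with x hx
    exact (hx.2 trivial).range_mono _ fun n => birkhoffSum_le_maxBirkhoff n x

theorem ae_eventually_birkhoffSum_div_lt [IsProbabilityMeasure μ] (hT : Ergodic T μ)
    (hfm : Measurable f) (hf : Integrable f μ) {c : ℝ} (hc : ∫ x, f x ∂μ < c) :
    ∀ᵐ x ∂μ, ∀ᶠ n : ℕ in atTop, birkhoffSum T f n x / n < c := by
  obtain ⟨d, hd, hdc⟩ := exists_between hc
  have hneg : ∫ x, (f x - d) ∂μ < 0 := by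
    rw [integral_sub hf (integrable_const d)]
    simpa using hd
  filter_upwards [ae_bddAbove_birkhoffSum hT (hfm.sub_const d) (hf.sub (integrable_const d)) hneg]
    with x ⟨K, hK⟩
  have hsum : ∀ n : ℕ, birkhoffSum T f n x ≤ n * d + K := fun n => by
    have := hK ⟨n, rfl⟩
    simp only [birkhoffSum, Finset.sum_sub_distrib, Finset.sum_const, Finset.card_range,
      nsmul_eq_mul] at this
    rw [birkhoffSum]
    linarith
  have hlim : Tendsto (fun n : ℕ => d + K / (n : ℝ)) atTop (𝓝 d) := by
    simpa using tendsto_const_nhds.add (tendsto_natCast_atTop_atTop.const_div_atTop K)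
  filter_upwards [hlim.eventually_lt_const hdc, eventually_gt_atTop 0] with n hn hn0
  have hn' : (0 : ℝ) < n := by exact_mod_cast hn0
  refine lt_of_le_of_lt ((div_le_iff₀ hn').2 ((hsum n).trans_eq ?_)) hn
  field_simp

theorem ae_tendsto_birkhoffSum_div_of_measurable [IsProbabilityMeasure μ] (hT : Ergodic T μ)
    (hfm : Measurable f) (hf : Integrable f μ) :
    ∀ᵐ x ∂μ, Tendsto (fun n : ℕ => birkhoffSum T f n x / n) atTop (𝓝 (∫ x, f x ∂μ)) := by
  have hupper : ∀ᵐ x ∂μ, ∀ j : ℕ, ∀ᶠ n : ℕ in atTop,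
      birkhoffSum T f n x / n < ∫ x, f x ∂μ + 1 / (j + 1 : ℝ) :=
    ae_all_iff.2 fun j => ae_eventually_birkhoffSum_div_lt hT hfm hf
      (lt_add_of_pos_right _ Nat.one_div_pos_of_nat)
  have hlower : ∀ᵐ x ∂μ, ∀ j : ℕ, ∀ᶠ n : ℕ in atTop,
      birkhoffSum T (-f) n x / n < -∫ x, f x ∂μ + 1 / (j + 1 : ℝ) :=
    ae_all_iff.2 fun j => ae_eventually_birkhoffSum_div_lt hT hfm.neg hf.neg
      ((integral_neg f).trans_lt (lt_add_of_pos_right _ Nat.one_div_pos_of_nat))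
  filter_upwards [hupper, hlower] with x hx hx'
  refine Metric.tendsto_nhds.2 fun ε hε => ?_
  obtain ⟨j, hj⟩ := exists_nat_one_div_lt hε
  filter_upwards [hx j, hx' j] with n hn hn'
  rw [birkhoffSum_neg, neg_div] at hn'
  rw [Real.dist_eq, abs_lt]
  constructor <;> linarith

theorem ae_tendsto_birkhoffSum_div [IsProbabilityMeasure μ] (hT : Ergodic T μ)
    (hf : Integrable f μ) :
    ∀ᵐ x ∂μ, Tendsto (fun n : ℕ => birkhoffSum T f n x / n) atTop (𝓝 (∫ x, f x ∂μ)) := by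
  have hfm := hf.1.aemeasurable
  have hae := hfm.ae_eq_mk
  filter_upwards [ae_tendsto_birkhoffSum_div_of_measurable hT hfm.measurable_mk (hf.congr hae),
    ae_all_iff.2 fun n => hT.quasiMeasurePreserving.birkhoffSum_ae_eq_of_ae_eq hae n]
    with x hx hsum
  rw [integral_congr_ae hae]
  exact hx.congr fun n => by rw [hsum n]

theorem ae_tendsto_birkhoffSum_div_complex [IsProbabilityMeasure μ] (hT : Ergodic T μ) {f : α → ℂ}
    (hf : Integrable f μ) :
    ∀ᵐ x ∂μ, Tendsto (fun n : ℕ => birkhoffSum T f n x / n) atTop (𝓝 (∫ x, f x ∂μ)) := by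
  filter_upwards [ae_tendsto_birkhoffSum_div hT hf.re, ae_tendsto_birkhoffSum_div hT hf.im]
    with x hre him
  have h := ((Complex.continuous_ofReal.tendsto _).comp hre).add
    (((Complex.continuous_ofReal.tendsto _).comp him).mul_const Complex.I)
  have hInt : ((∫ x, RCLike.re (f x) ∂μ : ℝ) : ℂ) + ((∫ x, RCLike.im (f x) ∂μ : ℝ) : ℂ) * Complex.I
      = ∫ x, f x ∂μ := integral_re_add_im hf
  rw [hInt] at h
  refine h.congr fun n => ?_
  apply Complex.ext <;> simp [birkhoffSum, Complex.div_natCast_re, Complex.div_natCast_im]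

theorem measurePreserving_zpow {T : Equiv.Perm α} (hT : MeasurePreserving T μ μ)
    (hT' : Measurable T.symm) (s : ℤ) : MeasurePreserving (T ^ s : Equiv.Perm α) μ μ := by
  let e : α ≃ᵐ α := ⟨T, hT.measurable, hT'⟩
  have hinv : MeasurePreserving T.symm μ μ := MeasurePreserving.symm e hT
  obtain ⟨n, rfl | rfl⟩ := s.eq_nat_or_neg
  · rw [zpow_natCast, Equiv.Perm.coe_pow]
    exact hT.iterate n
  · rw [zpow_neg, zpow_natCast, ← inv_pow, Equiv.Perm.coe_pow]
    exact hinv.iterate n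

theorem ae_tendsto_average_Icc [IsProbabilityMeasure μ] {T : Equiv.Perm α} (hT : Ergodic T μ)
    (hT' : Measurable T.symm) {f : α → ℂ} (hf : Integrable f μ) (s : ℤ) :
    ∀ᵐ x ∂μ, Tendsto (fun N : ℕ => (1 / (N : ℂ)) *
      ∑ i ∈ Finset.Icc s ((N : ℤ) + s - 1), f ((T ^ i) x)) atTop (𝓝 (∫ y, f y ∂μ)) := by
  filter_upwards [(measurePreserving_zpow hT.toMeasurePreserving hT' s).quasiMeasurePreserving.ae
    (ae_tendsto_birkhoffSum_div_complex hT hf)] with x hx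
  refine hx.congr fun N => ?_
  rw [sum_Icc_zpow_apply_eq_birkhoffSum, div_eq_inv_mul, one_div]

end Birkhoff

/-! ### Ergodicity from convergence of visit frequencies -/

section Ergodicity

variable {α : Type*} [MeasurableSpace α] {μ : Measure α} {T : α → α}

theorem integrable_birkhoffSum (hT : MeasurePreserving T μ μ) {f : α → ℝ} (hf : Integrable f μ)
    (N : ℕ) : Integrable (birkhoffSum T f N) μ :=
  integrable_finsetSum _ fun i _ => (hT.iterate i).integrable_comp_of_integrable hf

theorem integral_birkhoffSum (hT : MeasurePreserving T μ μ) {f : α → ℝ} (hf : Integrable f μ)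
    (N : ℕ) : ∫ x, birkhoffSum T f N x ∂μ = N * ∫ x, f x ∂μ := by
  have hcomp : ∀ i : ℕ, ∫ x, f (T^[i] x) ∂μ = ∫ x, f x ∂μ := fun i => by
    have hi := hT.iterate i
    conv_rhs => rw [← hi.map_eq]
    exact (integral_map hi.measurable.aemeasurable (hi.map_eq.symm ▸ hf.1)).symm
  have hInt : ∀ i : ℕ, Integrable (fun x => f (T^[i] x)) μ := fun i =>
    (hT.iterate i).integrable_comp_of_integrable hf
  simp only [birkhoffSum]
  rw [integral_finsetSum _ fun i _ => hInt i]
  simp [hcomp]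

/-- Both sides integrate over `B` the number of visits to `A` and its mean, up to `ε * N`. -/
theorem measureReal_inter_eq_mul [IsFiniteMeasure μ] (hT : MeasurePreserving T μ μ) {A B : Set α}
    (hA : MeasurableSet A) (hB : MeasurableSet B) (hTB : T ⁻¹' B = B)
    (h : ∀ ε > 0, ∃ N : ℕ, 0 < N ∧
      ∫ x, |birkhoffSum T (A.indicator 1) N x - N * μ.real A| ∂μ ≤ ε * N) :
    μ.real (A ∩ B) = μ.real A * μ.real B := by
  refine eq_of_forall_dist_le fun ε hε => ?_
  obtain ⟨N, hN, hle⟩ := h ε hε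
  have hN' : (0 : ℝ) < N := by exact_mod_cast hN
  have hTrestrict : MeasurePreserving T (μ.restrict B) (μ.restrict B) := by
    simpa only [hTB] using hT.restrict_preimage hB
  have hind : ∀ ν : Measure α, IsFiniteMeasure ν → Integrable (A.indicator (1 : α → ℝ)) ν :=
    fun ν _ => (integrable_const 1).indicator hA
  have hInt := (integrable_birkhoffSum hT (hind μ ‹_›) N).sub
    (integrable_const ((N : ℝ) * μ.real A))
  have hvisits : N * (μ.real (A ∩ B) - μ.real A * μ.real B) =
      ∫ x in B, (birkhoffSum T (A.indicator 1) N x - N * μ.real A) ∂μ := by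
    rw [integral_sub (integrable_birkhoffSum hTrestrict (hind _ inferInstance) N)
      (integrable_const _), integral_birkhoffSum hTrestrict (hind _ inferInstance),
      integral_indicator_one hA, measureReal_restrict_apply hA, setIntegral_const, smul_eq_mul]
    ring
  refine le_of_mul_le_mul_left ?_ hN'
  calc N * dist (μ.real (A ∩ B)) (μ.real A * μ.real B)
      = |∫ x in B, (birkhoffSum T (A.indicator 1) N x - N * μ.real A) ∂μ| := by
        rw [Real.dist_eq, ← hvisits, abs_mul, Nat.abs_cast]
    _ ≤ ∫ x in B, |birkhoffSum T (A.indicator 1) N x - N * μ.real A| ∂μ :=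
        abs_integral_le_integral_abs
    _ ≤ ∫ x, |birkhoffSum T (A.indicator 1) N x - N * μ.real A| ∂μ :=
        setIntegral_le_integral hInt.abs (Eventually.of_forall fun _ => abs_nonneg _)
    _ ≤ N * ε := hle.trans_eq (mul_comm _ _)

theorem ergodic_of_restrict_eq_smul (hT : MeasurePreserving T μ μ)
    (h : ∀ B, MeasurableSet B → T ⁻¹' B = B → μ.restrict B = μ B • μ) : Ergodic T μ := by
  refine ⟨hT, ⟨fun B hB hTB => eventuallyConst_set'.2 ?_⟩⟩
  have hzero : μ B * μ Bᶜ = 0 := by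
    rw [← smul_eq_mul, ← Measure.smul_apply, ← h B hB hTB, Measure.restrict_apply hB.compl,
      Set.compl_inter_self, measure_empty]
  exact (mul_eq_zero.1 hzero).imp ae_eq_empty.2 ae_eq_univ.2

end Ergodicity

/-! ### Limits of means on a compact space -/

/-- The ultrafilter limit is a positive functional, so the Riesz–Markov–Kakutani theorem applies. -/
theorem exists_measure_tendsto_of_means {ι X : Type*} [TopologicalSpace X] [CompactSpace X]
    [T2Space X] [MeasurableSpace X] [BorelSpace X] (Λ : ι → (X → ℝ) →ₗ[ℝ] ℝ)
    (hmono : ∀ i, Monotone (Λ i)) (hone : ∀ i, Λ i 1 = 1) (U : Ultrafilter ι) :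
    ∃ μ : Measure X, IsProbabilityMeasure μ ∧
      ∀ f : C(X, ℝ), Tendsto (fun i => Λ i f) U (𝓝 (∫ x, f x ∂μ)) := by
  have hconst : ∀ i (c : ℝ), Λ i (fun _ => c) = c := fun i c => by
    rw [show (fun _ : X => c) = c • 1 from funext fun _ => (mul_one c).symm, map_smul, hone,
      smul_eq_mul, mul_one]
  have hlim : ∀ f : C(X, ℝ), ∃ c, Tendsto (fun i => Λ i f) U (𝓝 c) := by
    intro f
    have hmem : ∀ i, Λ i f ∈ Set.Icc (-‖f‖) ‖f‖ := fun i =>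
      ⟨(hconst i (-‖f‖)).symm.le.trans (hmono i fun x => f.neg_norm_le_apply x),
        (hmono i fun x => f.apply_le_norm x).trans (hconst i ‖f‖).le⟩
    obtain ⟨c, -, hc⟩ := isCompact_Icc.ultrafilter_le_nhds' (U.map fun i => Λ i f)
      (Eventually.of_forall hmem : ∀ᶠ i in U, Λ i f ∈ Set.Icc (-‖f‖) ‖f‖)
    exact ⟨c, hc⟩
  choose L hL using hlim
  let Φ : CompactlySupportedContinuousMap X ℝ →ₚ[ℝ] ℝ :=
    { toFun := fun f => L f.toContinuousMap
      map_add' := fun f g => tendsto_nhds_unique (hL _)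
        (((hL f.toContinuousMap).add (hL g.toContinuousMap)).congr fun i =>
          (map_add (Λ i) _ _).symm)
      map_smul' := fun c f => tendsto_nhds_unique (hL _)
        (((hL f.toContinuousMap).const_mul c).congr fun i => (map_smul (Λ i) _ _).symm)
      monotone' := fun f g hfg => le_of_tendsto_of_tendsto' (hL f.toContinuousMap)
        (hL g.toContinuousMap) fun i => hmono i hfg }
  have hInt : ∀ f : C(X, ℝ), ∫ x, f x ∂(RealRMK.rieszMeasure Φ) = L f := fun f =>
    RealRMK.integral_rieszMeasure Φ (CompactlySupportedContinuousMap.continuousMapEquiv f)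
  refine ⟨RealRMK.rieszMeasure Φ, ⟨?_⟩, fun f => hInt f ▸ hL f⟩
  have hL_one : L 1 = 1 :=
    tendsto_nhds_unique (hL 1) (tendsto_const_nhds.congr fun i => (hone i).symm)
  have hreal := hInt 1
  simp only [hL_one, ContinuousMap.one_apply, integral_const, smul_eq_mul, mul_one] at hreal
  rwa [measureReal_def, ENNReal.toReal_eq_one_iff] at hreal

/-! ### Cylinder sets -/

section Cylinder

variable {m : ℕ} {ℓ : ℕ}

instance : BorelSpace (ℤ → Letter) := Pi.borelSpace

theorem continuous_hullShift : Continuous (hullShift m) := by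
  refine Continuous.subtype_mk (f := fun x : hull m => shift (x : ℤ → Letter)) ?_ _
  exact continuous_pi fun i => (continuous_apply (i + 1)).comp continuous_subtype_val

theorem continuous_hullShift_symm : Continuous (hullShift m).symm := by
  refine Continuous.subtype_mk (f := fun x : hull m => shift.symm (x : ℤ → Letter)) ?_ _
  exact continuous_pi fun i => (continuous_apply (i - 1)).comp continuous_subtype_val

theorem coe_hullShift (x : hull m) : (hullShift m x : ℤ → Letter) = shift x := rfl

theorem coe_iterate_hullShift (i : ℕ) (x : hull m) :
    ((hullShift m)^[i] x : ℤ → Letter) = shift^[i] x :=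
  Function.Semiconj.iterate_right (f := ((↑) : hull m → ℤ → Letter)) coe_hullShift i x

theorem mem_cylinder_iff {k : ℤ} {w : Fin ℓ → Letter} {x : hull m} :
    x ∈ cylinder m k w ↔ factor x k ℓ = List.ofFn w := by
  rw [factor, List.ofFn_inj, funext_iff]
  rfl

theorem isClopen_cylinder (k : ℤ) (w : Fin ℓ → Letter) : IsClopen (cylinder m k w) := by
  have h : cylinder m k w =
      ⋂ j : Fin ℓ, (fun x : hull m => (x : ℤ → Letter) (k + (j : ℕ))) ⁻¹' {w j} := by
    ext x
    simp [cylinder]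
  rw [h]
  exact isClopen_iInter_of_finite fun j => (isClopen_discrete _).preimage
    ((continuous_apply _).comp continuous_subtype_val)

theorem measurableSet_cylinder (k : ℤ) (w : Fin ℓ → Letter) : MeasurableSet (cylinder m k w) :=
  (isClopen_cylinder k w).isOpen.measurableSet

theorem preimage_hullShift_cylinder (k : ℤ) (w : Fin ℓ → Letter) :
    hullShift m ⁻¹' cylinder m k w = cylinder m (k + 1) w := by
  ext x
  rw [Set.mem_preimage, mem_cylinder_iff, mem_cylinder_iff, coe_hullShift, factor_shift]

theorem cylinder_eq_empty (hm : 1 ≤ m) (k : ℤ) {w : Fin ℓ → Letter}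
    (hw : ¬IsLegal m (List.ofFn w)) : cylinder m k w = ∅ :=
  Set.eq_empty_of_forall_notMem fun x hx =>
    hw (mem_cylinder_iff.1 hx ▸ isLegal_factor hm x.2 k ℓ)

/-- The cylinder sets over the symmetric windows `[-n, n]`; unlike all cylinder sets they form a
π-system. -/
def centralCylinders (m : ℕ) : Set (Set (hull m)) :=
  {s | ∃ (n : ℕ) (w : Fin (2 * n + 1) → Letter), s = cylinder m (-n) w}

theorem mem_centralCylinder_iff {n : ℕ} {w : Fin (2 * n + 1) → Letter} {x : hull m}
    (hx : x ∈ cylinder m (-n) w) (y : hull m) :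
    y ∈ cylinder m (-n) w ↔ ∀ i : ℤ, -n ≤ i → i ≤ n → (y : ℤ → Letter) i = (x : ℤ → Letter) i := by
  constructor
  · intro hy i h₁ h₂
    have hi : (-n : ℤ) + (i + n).toNat = i := by omega
    have hxy := (hy ⟨(i + n).toNat, by omega⟩).trans (hx ⟨(i + n).toNat, by omega⟩).symm
    rwa [hi] at hxy
  · intro h j
    rw [h _ (by omega) (by omega)]
    exact hx j

theorem isPiSystem_centralCylinders : IsPiSystem (centralCylinders m) := by
  rintro _ ⟨n, w, rfl⟩ _ ⟨n', w', rfl⟩ ⟨x, hx, hx'⟩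
  rcases le_total n n' with h | h
  · refine ⟨n', w', Set.inter_eq_right.2 fun y hy => ?_⟩
    rw [mem_centralCylinder_iff hx'] at hy
    exact (mem_centralCylinder_iff hx y).2 fun i h₁ h₂ => hy i (by omega) (by omega)
  · refine ⟨n, w, Set.inter_eq_left.2 fun y hy => ?_⟩
    rw [mem_centralCylinder_iff hx] at hy
    exact (mem_centralCylinder_iff hx' y).2 fun i h₁ h₂ => hy i (by omega) (by omega)

theorem preimage_apply_eq_iUnion_cylinder (i : ℤ) (l : Letter) :
    (fun x : hull m => (x : ℤ → Letter) i) ⁻¹' {l} =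
      ⋃ w : {w : Fin (2 * i.natAbs + 1) → Letter // w ⟨(i + i.natAbs).toNat, by omega⟩ = l},
        cylinder m (-i.natAbs) w.1 := by
  have hi : (-(i.natAbs : ℤ)) + (i + i.natAbs).toNat = i := by omega
  ext x
  simp only [Set.mem_preimage, Set.mem_singleton_iff, Set.mem_iUnion]
  constructor
  · intro hx
    exact ⟨⟨fun j => (x : ℤ → Letter) (-i.natAbs + (j : ℕ)), by simp only [hi, hx]⟩, fun _ => rfl⟩
  · rintro ⟨⟨w, hw⟩, hx⟩
    have := hx ⟨(i + i.natAbs).toNat, by omega⟩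
    simp only [hi] at this
    rw [this, hw]

theorem generateFrom_centralCylinders :
    (inferInstance : MeasurableSpace (hull m)) =
      MeasurableSpace.generateFrom (centralCylinders m) := by
  refine le_antisymm (measurable_iff_comap_le.1 ?_) (MeasurableSpace.generateFrom_le ?_)
  · refine @measurable_pi_lambda _ _ _ (MeasurableSpace.generateFrom (centralCylinders m)) _ _
      fun i => ?_
    refine @measurable_to_countable' _ _ _ _ (MeasurableSpace.generateFrom (centralCylinders m)) _
      fun l => ?_
    rw [preimage_apply_eq_iUnion_cylinder]
    exact MeasurableSet.iUnion fun w => MeasurableSpace.measurableSet_generateFrom ⟨_, _, rfl⟩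
  · rintro _ ⟨n, w, rfl⟩
    exact measurableSet_cylinder _ _

theorem measure_univ_eq_sum_cylinder (μ : Measure (hull m)) :
    μ Set.univ = ∑ l : Letter, μ (cylinder m 0 fun _ : Fin 1 => l) := by
  have hunion : (Set.univ : Set (hull m)) = ⋃ l : Letter, cylinder m 0 fun _ : Fin 1 => l := by
    refine (Set.eq_univ_of_forall fun x => ?_).symm
    exact Set.mem_iUnion.2 ⟨(x : ℤ → Letter) 0, fun j => by simp⟩
  have hdisj : Pairwise (Function.onFun Disjoint
      fun l : Letter => cylinder m 0 fun _ : Fin 1 => l) := fun l l' hne =>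
    Set.disjoint_left.2 fun x hx hx' => hne ((hx 0).symm.trans (hx' 0))
  rw [hunion, measure_iUnion hdisj fun l => measurableSet_cylinder _ _, tsum_fintype]

theorem ext_of_cylinder {μ ν : Measure (hull m)} [IsFiniteMeasure μ]
    (h : ∀ ℓ, 1 ≤ ℓ → ∀ (k : ℤ) (w : Fin ℓ → Letter),
      μ (cylinder m k w) = ν (cylinder m k w)) : μ = ν := by
  refine ext_of_generate_finite _ generateFrom_centralCylinders isPiSystem_centralCylinders ?_ ?_
  · rintro _ ⟨n, w, rfl⟩
    exact h _ (by omega) _ _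
  · simp only [measure_univ_eq_sum_cylinder, h 1 le_rfl]

theorem indicator_cylinder_iterate_hullShift (w : Fin ℓ → Letter) (x : hull m) {i N : ℕ}
    (h : i + ℓ ≤ N) : (cylinder m 0 w).indicator (1 : hull m → ℝ) ((hullShift m)^[i] x) =
      prefixInd (List.ofFn w) ((factor x 0 N).drop i) := by
  have hmem : (hullShift m)^[i] x ∈ cylinder m 0 w ↔
      List.ofFn w <+: (factor x 0 N).drop i := by
    rw [mem_cylinder_iff, coe_iterate_hullShift, factor_iterate_shift, drop_factor,
      List.prefix_iff_eq_take, List.length_ofFn, take_factor _ _ (by omega), eq_comm]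
  classical
  simp only [Set.indicator_apply, prefixInd, hmem, Pi.one_apply]

theorem abs_birkhoffSum_sub_occ_le (w : Fin ℓ → Letter) (x : hull m) (N : ℕ) :
    |birkhoffSum (hullShift m) ((cylinder m 0 w).indicator 1) N x -
      occ (List.ofFn w) (factor x 0 N)| ≤ ℓ := by
  rw [occ, tailSum_eq_sum_range, length_factor, birkhoffSum, ← Finset.sum_sub_distrib]
  have hterm : ∀ i ∈ Finset.range N,
      |(cylinder m 0 w).indicator (1 : hull m → ℝ) ((hullShift m)^[i] x) -
        prefixInd (List.ofFn w) ((factor x 0 N).drop i)| ≤ if N < i + ℓ then 1 else 0 := by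
    intro i _
    split_ifs with h
    · exact abs_sub_le_of_nonneg_of_le (Set.indicator_nonneg (fun _ _ => zero_le_one) _)
        (Set.indicator_le_self' (fun _ _ => zero_le_one) _) (prefixInd_nonneg _ _)
        (prefixInd_le_one _ _)
    · rw [indicator_cylinder_iterate_hullShift w x (not_lt.1 h), sub_self, abs_zero]
  refine (Finset.abs_sum_le_sum_abs _ _).trans ((Finset.sum_le_sum hterm).trans ?_)
  rw [Finset.sum_boole]
  have hsub : (Finset.range N).filter (fun i => N < i + ℓ) ⊆ Finset.Ico (N - ℓ) N := by
    intro i hi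
    simp only [Finset.mem_filter, Finset.mem_range, Finset.mem_Ico] at hi ⊢
    omega
  have hcard := Finset.card_le_card hsub
  rw [Nat.card_Ico] at hcard
  exact_mod_cast hcard.trans (by omega)

end Cylinder

/-! ### The frequency measure -/

section FrequencyMeasure

variable {m : ℕ} {p : Fin (m + 1) → ℝ}

/-- The shift-invariant probability measures on the hull that give every cylinder set the frequency
of its word. Invariance makes it enough to prescribe the cylinder sets at position `0`. -/
structure IsFrequencyMeasure (p : Fin (m + 1) → ℝ) (μ : Measure (hull m)) : Prop where
  isProbabilityMeasure : IsProbabilityMeasure μ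
  measurePreserving : MeasurePreserving (hullShift m) μ μ
  measureReal_cylinder : ∀ {ℓ : ℕ} (w : Fin ℓ → Letter),
    μ.real (cylinder m 0 w) = freq p (List.ofFn w)

/-- The expected mean of `f` along the orbit of `pt v` over `v.length` steps, where `v` is the
random word `ζ_m^n(a)`; `pt` chooses for every legal word an element of the hull that continues
it. -/
def orbitMean (p : Fin (m + 1) → ℝ) (pt : List Letter → hull m) (n : ℕ) :
    (hull m → ℝ) →ₗ[ℝ] ℝ where
  toFun f := (expect p)^[n] (fun v => birkhoffSum (hullShift m) f v.length (pt v)) [Letter.a] /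
    imageLen m n Letter.a
  map_add' f g := by
    simp only [birkhoffSum, Pi.add_apply, Finset.sum_add_distrib, iterate_expect_add, add_div]
  map_smul' c f := by
    simp only [birkhoffSum, Pi.smul_apply, smul_eq_mul, ← Finset.mul_sum,
      iterate_expect_const_mul, mul_div_assoc, RingHom.id_apply]

theorem monotone_orbitMean (P : IsPosProb p) (pt : List Letter → hull m) (n : ℕ) :
    Monotone (orbitMean p pt n) := fun _ _ hfg =>
  div_le_div_of_nonneg_right
    (iterate_expect_mono P fun _ _ => Finset.sum_le_sum fun _ _ => hfg _) (Nat.cast_nonneg _)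

theorem orbitMean_one (P : IsPosProb p) (pt : List Letter → hull m) (n : ℕ) :
    orbitMean p pt n 1 = 1 := by
  have hlen : (expect p)^[n] (fun v => birkhoffSum (hullShift m) (1 : hull m → ℝ) v.length (pt v))
      [Letter.a] = imageLen m n Letter.a :=
    iterate_expect_eq_const P fun v hv => by
      simp [birkhoffSum, hv.length_eq]
  exact (congrArg (· / (imageLen m n Letter.a : ℝ)) hlen).trans
    (div_self (Nat.cast_ne_zero.2 (imageLen_pos n Letter.a).ne'))

theorem tendsto_orbitMean_comp_hullShift_sub (hm : 1 ≤ m) (P : IsPosProb p)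
    (pt : List Letter → hull m) {f : hull m → ℝ} {C : ℝ} (hf : ∀ x, |f x| ≤ C) :
    Tendsto (fun n => orbitMean p pt n (f ∘ hullShift m - f)) atTop (𝓝 0) := by
  refine tendsto_div_imageLen_of_abs_sub_le hm (C := C + C) (α := fun _ => 0) (fun n => ?_)
    (by simp)
  rw [← iterate_expect_const P n [Letter.a] 0]
  refine abs_iterate_expect_sub_le P fun v _ => ?_
  have htelescope : birkhoffSum (hullShift m) (f ∘ hullShift m - f) v.length (pt v) =
      f ((hullShift m)^[v.length] (pt v)) - f (pt v) := by
    simp only [birkhoffSum, Pi.sub_apply, Function.comp_apply, ← Function.iterate_succ_apply']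
    exact Finset.sum_range_sub (fun i => f ((hullShift m)^[i] (pt v))) _
  rw [zero_sub, abs_neg, htelescope]
  exact (abs_sub _ _).trans (add_le_add (hf _) (hf _))

theorem tendsto_orbitMean_cylinder (hm : 1 ≤ m) (P : IsPosProb p) {pt : List Letter → hull m}
    (hpt : ∀ v, IsLegal m v → factor (pt v) 0 v.length = v) {ℓ : ℕ} (w : Fin ℓ → Letter) :
    Tendsto (fun n => orbitMean p pt n ((cylinder m 0 w).indicator 1)) atTop
      (𝓝 (freq p (List.ofFn w))) := by
  refine tendsto_div_imageLen_of_abs_sub_le hm (C := ℓ) (fun n => ?_)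
    (tendsto_freq hm P (List.ofFn w))
  refine abs_iterate_expect_sub_le P fun v hv => ?_
  have h := abs_birkhoffSum_sub_occ_le w (pt v) v.length
  rwa [hpt v hv.isLegal, abs_sub_comm] at h

theorem exists_hull_continuation (hm : 1 ≤ m) :
    ∃ pt : List Letter → hull m, ∀ v, IsLegal m v → factor (pt v) 0 v.length = v := by
  obtain ⟨x₀, hx₀, -⟩ := (isLegal_aa hm).exists_mem_hull hm
  have : Nonempty (hull m) := ⟨⟨x₀, hx₀⟩⟩
  have h : ∀ v, IsLegal m v → ∃ x : hull m, factor x 0 v.length = v := fun v hv =>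
    let ⟨x, hx, hxv⟩ := hv.exists_mem_hull hm
    ⟨⟨x, hx⟩, hxv⟩
  choose! pt hpt using h
  exact ⟨pt, hpt⟩

theorem exists_isFrequencyMeasure (hm : 1 ≤ m) (P : IsPosProb p) :
    ∃ μ : Measure (hull m), IsFrequencyMeasure p μ := by
  obtain ⟨pt, hpt⟩ := exists_hull_continuation hm
  obtain ⟨μ, hμ, hlim⟩ := exists_measure_tendsto_of_means (orbitMean p pt)
    (monotone_orbitMean P pt) (orbitMean_one P pt) (Ultrafilter.of atTop)
  have hU : (Ultrafilter.of (atTop : Filter ℕ) : Filter ℕ) ≤ atTop := Ultrafilter.of_le _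
  have hS : AEMeasurable (hullShift m) μ := continuous_hullShift.measurable.aemeasurable
  refine ⟨μ, hμ, ⟨continuous_hullShift.measurable, ?_⟩, fun {ℓ} w => ?_⟩
  · have : IsProbabilityMeasure (μ.map (hullShift m)) := Measure.isProbabilityMeasure_map hS
    refine ext_of_forall_integral_eq_of_IsFiniteMeasure fun f => ?_
    rw [integral_map hS f.continuous.aestronglyMeasurable]
    have hsub := (hlim (f.toContinuousMap.comp ⟨hullShift m, continuous_hullShift⟩)).sub
      (hlim f.toContinuousMap)
    refine sub_eq_zero.1 (tendsto_nhds_unique (hsub.congr fun n => (map_sub _ _ _).symm) ?_)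
    exact (tendsto_orbitMean_comp_hullShift_sub hm P pt f.norm_coe_le_norm).mono_left hU
  · let F : C(hull m, ℝ) := ⟨(cylinder m 0 w).indicator 1, continuous_one.indicator fun x hx => by
      rw [(isClopen_cylinder 0 w).frontier_eq] at hx
      exact absurd hx (Set.notMem_empty x)⟩
    rw [← integral_indicator_one (measurableSet_cylinder 0 w)]
    exact tendsto_nhds_unique (hlim F) ((tendsto_orbitMean_cylinder hm P hpt w).mono_left hU)

variable {μ : Measure (hull m)}

theorem measure_cylinder_eq (hμ : MeasurePreserving (hullShift m) μ μ) {ℓ : ℕ} (k : ℤ)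
    (w : Fin ℓ → Letter) : μ (cylinder m k w) = μ (cylinder m 0 w) := by
  have hstep : ∀ k : ℤ, μ (cylinder m (k + 1) w) = μ (cylinder m k w) := fun k => by
    rw [← preimage_hullShift_cylinder,
      hμ.measure_preimage (measurableSet_cylinder k w).nullMeasurableSet]
  induction k using Int.induction_on with
  | zero => rfl
  | succ i ih => rw [hstep, ih]
  | pred i ih => rw [← ih, ← hstep, sub_add_cancel]

theorem IsFrequencyMeasure.measure_cylinder (hμ : IsFrequencyMeasure p μ) (k : ℤ) {ℓ : ℕ}
    (w : Fin ℓ → Letter) : μ (cylinder m k w) = ENNReal.ofReal (freq p (List.ofFn w)) := by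
  have := hμ.isProbabilityMeasure
  rw [measure_cylinder_eq hμ.measurePreserving, ← hμ.measureReal_cylinder, ofReal_measureReal]

theorem IsFrequencyMeasure.hasPFCylinders (hμ : IsFrequencyMeasure p μ) (hm : 1 ≤ m)
    (P : IsPosProb p) : HasPFCylinders m p μ := fun _ hℓ =>
  ⟨_, isRightPF_freq hm P hℓ, fun k w => hμ.measure_cylinder k w.1⟩

theorem IsFrequencyMeasure.eq_of_hasPFCylinders (hμ : IsFrequencyMeasure p μ) (hm : 1 ≤ m)
    (P : IsPosProb p) {ν : Measure (hull m)} (hν : HasPFCylinders m p ν) : μ = ν := by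
  have := hμ.isProbabilityMeasure
  refine ext_of_cylinder fun ℓ hℓ k w => ?_
  by_cases hw : IsLegal m (List.ofFn w)
  · obtain ⟨R, hR, hνR⟩ := hν ℓ hℓ
    rw [hνR k ⟨w, hw⟩, hR.eq_freq hm P hℓ, hμ.measure_cylinder]
  · rw [cylinder_eq_empty hm k hw, measure_empty, measure_empty]

end FrequencyMeasure

/-! ### Ergodicity of the frequency measure -/

section FrequencyMeasureErgodic

variable {m : ℕ} {p : Fin (m + 1) → ℝ} {μ : Measure (hull m)}

theorem apply_factor_eq_sum (hm : 1 ≤ m) (N : ℕ) (φ : List Letter → ℝ) (x : hull m) :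
    φ (factor x 0 N) =
      ∑ w : LegalWord m N, φ (List.ofFn w.1) * (cylinder m 0 w.1).indicator 1 x := by
  let w₀ : LegalWord m N := ⟨fun j => (x : ℤ → Letter) (0 + (j : ℕ)), isLegal_factor hm x.2 0 N⟩
  have hw₀ : x ∈ cylinder m 0 w₀.1 := fun _ => rfl
  rw [Finset.sum_eq_single w₀, Set.indicator_of_mem hw₀, Pi.one_apply, mul_one]
  · rfl
  · intro w _ hw
    have hxw : x ∉ cylinder m 0 w.1 := fun h => hw (Subtype.ext (funext fun j => (h j).symm))
    rw [Set.indicator_of_notMem hxw, mul_zero]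
  · exact fun h => absurd (Finset.mem_univ _) h

theorem integrable_mul_indicator_cylinder [IsFiniteMeasure μ] (c : ℝ) {ℓ : ℕ}
    (w : Fin ℓ → Letter) :
    Integrable (fun x => c * (cylinder m 0 w).indicator (1 : hull m → ℝ) x) μ :=
  ((integrable_const (1 : ℝ)).indicator (measurableSet_cylinder 0 w)).const_mul c

theorem integrable_apply_factor [IsFiniteMeasure μ] (hm : 1 ≤ m) (N : ℕ) (φ : List Letter → ℝ) :
    Integrable (fun x : hull m => φ (factor x 0 N)) μ := by
  simp only [apply_factor_eq_sum hm N φ]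
  exact integrable_finsetSum _ fun w _ => integrable_mul_indicator_cylinder _ w.1

theorem IsFrequencyMeasure.integral_apply_factor (hμ : IsFrequencyMeasure p μ) (hm : 1 ≤ m)
    (N : ℕ) (φ : List Letter → ℝ) : ∫ x : hull m, φ (factor x 0 N) ∂μ =
      ∑ w : LegalWord m N, φ (List.ofFn w.1) * freq p (List.ofFn w.1) := by
  have := hμ.isProbabilityMeasure
  simp only [apply_factor_eq_sum hm N φ]
  rw [integral_finsetSum _ fun w _ => integrable_mul_indicator_cylinder _ w.1]
  refine Finset.sum_congr rfl fun w _ => ?_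
  rw [integral_const_mul, integral_indicator_one (measurableSet_cylinder 0 w.1),
    hμ.measureReal_cylinder]

theorem abs_le_div_add_half {c : ℝ} (hc : 0 < c) (t : ℝ) : |t| ≤ t ^ 2 / (2 * c) + c / 2 := by
  rw [← sub_nonneg]
  have h : t ^ 2 / (2 * c) + c / 2 - |t| = (|t| - c) ^ 2 / (2 * c) := by
    rw [← sq_abs t]
    field_simp
    ring
  rw [h]
  positivity

theorem IsFrequencyMeasure.eventually_integral_abs_occDev_le (hμ : IsFrequencyMeasure p μ)
    (hm : 1 ≤ m) (P : IsPosProb p) (u : List Letter) {ε : ℝ} (hε : 0 < ε) :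
    ∀ᶠ N : ℕ in atTop, ∫ x : hull m, |occDev u (freq p u) (factor x 0 N)| ∂μ ≤ ε * N := by
  have := hμ.isProbabilityMeasure
  filter_upwards [eventually_sum_occDev_sq_le hm P u (pow_pos hε 2), eventually_gt_atTop 0]
    with N hN hN₀
  have hc : 0 < ε * (N : ℝ) := mul_pos hε (Nat.cast_pos.2 hN₀)
  have hInt : ∀ φ : List Letter → ℝ, Integrable (fun x : hull m => φ (factor x 0 N)) μ :=
    integrable_apply_factor hm N
  calc ∫ x : hull m, |occDev u (freq p u) (factor x 0 N)| ∂μ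
      ≤ ∫ x : hull m, (occDev u (freq p u) (factor x 0 N) ^ 2 / (2 * (ε * N)) + ε * N / 2) ∂μ :=
        integral_mono (hInt fun v => |occDev u (freq p u) v|)
          (hInt fun v => occDev u (freq p u) v ^ 2 / (2 * (ε * N)) + ε * N / 2)
          fun x => abs_le_div_add_half hc _
    _ = (∑ w : LegalWord m N, occDev u (freq p u) (List.ofFn w.1) ^ 2 * freq p (List.ofFn w.1)) /
          (2 * (ε * N)) + ε * N / 2 := by
        rw [integral_add (hInt fun v => occDev u (freq p u) v ^ 2 / (2 * (ε * N)))
          (integrable_const _), integral_div,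
          hμ.integral_apply_factor hm N fun v => occDev u (freq p u) v ^ 2, integral_const,
          probReal_univ, one_smul]
    _ ≤ ε ^ 2 * (N : ℝ) ^ 2 / (2 * (ε * N)) + ε * N / 2 := by gcongr
    _ = ε * N := by
        field_simp
        ring

theorem IsFrequencyMeasure.exists_integral_abs_birkhoffSum_sub_le (hμ : IsFrequencyMeasure p μ)
    (hm : 1 ≤ m) (P : IsPosProb p) {ℓ : ℕ} (w : Fin ℓ → Letter) {ε : ℝ} (hε : 0 < ε) :
    ∃ N : ℕ, 0 < N ∧ ∫ x, |birkhoffSum (hullShift m) ((cylinder m 0 w).indicator 1) N x -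
      N * μ.real (cylinder m 0 w)| ∂μ ≤ ε * N := by
  have := hμ.isProbabilityMeasure
  have hlarge : Tendsto (fun N : ℕ => ε / 2 * (N : ℝ)) atTop atTop :=
    tendsto_natCast_atTop_atTop.const_mul_atTop (half_pos hε)
  obtain ⟨N, hdev, hℓ, hN⟩ := ((hμ.eventually_integral_abs_occDev_le hm P (List.ofFn w)
    (half_pos hε)).and ((hlarge.eventually_ge_atTop ℓ).and (eventually_gt_atTop 0))).exists
  refine ⟨N, hN, ?_⟩
  have hocc := integrable_apply_factor (μ := μ) hm N
    fun v => |occDev (List.ofFn w) (freq p (List.ofFn w)) v|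
  have hvisits := integrable_birkhoffSum hμ.measurePreserving
    ((integrable_const (1 : ℝ)).indicator (measurableSet_cylinder 0 w)) N
  calc ∫ x, |birkhoffSum (hullShift m) ((cylinder m 0 w).indicator 1) N x -
        N * μ.real (cylinder m 0 w)| ∂μ
      ≤ ∫ x : hull m, (ℓ + |occDev (List.ofFn w) (freq p (List.ofFn w)) (factor x 0 N)|) ∂μ := by
        refine integral_mono (hvisits.sub (integrable_const _)).abs
          ((integrable_const _).add hocc) fun x => ?_
        refine (abs_sub_le _ (occ (List.ofFn w) (factor x 0 N)) _).trans
          (add_le_add (abs_birkhoffSum_sub_occ_le w x N) (le_of_eq ?_))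
        rw [occDev, length_factor, hμ.measureReal_cylinder, mul_comm]
    _ = ℓ + ∫ x : hull m, |occDev (List.ofFn w) (freq p (List.ofFn w)) (factor x 0 N)| ∂μ := by
        rw [integral_add (integrable_const _) hocc, integral_const, probReal_univ, one_smul]
    _ ≤ ε / 2 * N + ε / 2 * N := add_le_add hℓ hdev
    _ = ε * N := by ring

theorem IsFrequencyMeasure.ergodic (hμ : IsFrequencyMeasure p μ) (hm : 1 ≤ m)
    (P : IsPosProb p) : Ergodic (hullShift m) μ := by
  have := hμ.isProbabilityMeasure
  refine ergodic_of_restrict_eq_smul hμ.measurePreserving fun B hB hSB => ?_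
  have hrestrict : MeasurePreserving (hullShift m) (μ.restrict B) (μ.restrict B) := by
    simpa only [hSB] using hμ.measurePreserving.restrict_preimage hB
  refine ext_of_cylinder fun ℓ _ k w => ?_
  rw [measure_cylinder_eq hrestrict, Measure.smul_apply, measure_cylinder_eq hμ.measurePreserving,
    Measure.restrict_apply (measurableSet_cylinder 0 w), smul_eq_mul, mul_comm,
    ← ENNReal.toReal_eq_toReal_iff' (measure_ne_top _ _) (by finiteness), ENNReal.toReal_mul]
  exact measureReal_inter_eq_mul hμ.measurePreserving (measurableSet_cylinder 0 w) hB hSB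
    fun ε hε => hμ.exists_integral_abs_birkhoffSum_sub_le hm P w hε

end FrequencyMeasureErgodic

end RNMS

end

open RNMS

theorem theorem1 (m : ℕ) (hm : 1 ≤ m) (p : Fin (m + 1) → ℝ) (hp : ∀ i, 0 < p i)
    (hp_sum : ∑ i, p i = 1) :
    ∃ μ : Measure (RNMS.hull m),
      RNMS.HasPFCylinders m p μ ∧
      (∀ ν : Measure (RNMS.hull m), RNMS.HasPFCylinders m p ν → ν = μ) ∧
      IsProbabilityMeasure μ ∧
      MeasurePreserving (RNMS.hullShift m) μ μ ∧
      (∀ f : RNMS.hull m → ℂ, Integrable f μ → ∀ s : ℤ, ∀ᵐ x ∂μ,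
        Tendsto
          (fun N : ℕ => (1 / (N : ℂ)) *
            ∑ i ∈ Finset.Icc s ((N : ℤ) + s - 1), f ((RNMS.hullShift m ^ i) x))
          atTop (𝓝 (∫ y, f y ∂μ))) ∧
      Ergodic (RNMS.hullShift m) μ := by
  have P : IsPosProb p := ⟨hp, hp_sum⟩
  obtain ⟨μ, hμ⟩ := exists_isFrequencyMeasure hm P
  have := hμ.isProbabilityMeasure
  have herg : Ergodic (hullShift m) μ := hμ.ergodic hm P
  exact ⟨μ, hμ.hasPFCylinders hm P, fun _ hν => (hμ.eq_of_hasPFCylinders hm P hν).symm,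
    hμ.isProbabilityMeasure, hμ.measurePreserving,
    fun _ hf s => ae_tendsto_average_Icc herg continuous_hullShift_symm.measurable hf s, herg⟩
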